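/- Let $\lambda=(\lambda_1,\dots,\lambda_\ell)$ be an integer partition (possibly empty), and let $S(\lambda)$ be the spider with leg lengths $\lambda_1,\dots,\lambda_\ell$, that is, the tree obtained from a vertex (the torso) by attaching to it $\ell$ pendent paths with $\lambda_1,\dots,\lambda_\ell$ further vertices. Then: (a) the symmetric function $Y_{S(\lambda)}$ is 2-Schur-positive, and (equivalently) (b) the independence polynomial $I_{S(\lambda)}(t)$ is strongly log-concave. Here, for a finite graph $G$ with vertex set $V$ and $\alpha:V\to\mathbb{N}$, $X_G^\alpha=\sum_\kappa\prod_{v\in V}\prod_{i\in\kappa(v)}x_i$, where $\kappa$ runs over the proper multicolorings of type $\alpha$, i.e. the maps from $V$ to the finite sets of positive integers with $|\kappa(v)|=\alpha(v)$ for all $v$ and $\kappa(u)\cap\kappa(v)=\emptyset$ for all edges $uv$; and $Y_G=\sum_{\alpha:V\to\mathbb{N}}X_G^\alpha$, a formal power series in $x_1,x_2,\dots$. A symmetric formal power series $f$ over $\mathbb{Q}$ is 2-Schur-positive if, in its (possibly infinite) expansion $f=\sum_\mu c_\mu s_\mu$ in Schur functions, $c_\mu\ge 0$ for every partition $\mu$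 of length at most $2$. The independence polynomial is $I_G(t)=\sum_j i_jt^j$, where $i_j$ is the number of independent sets of $G$ of cardinality $j$. A polynomial $a_0+a_1t+\dots+a_dt^d$ of degree $d$ is strongly log-concave if $a_ma_n\ge a_pa_q$ for all integers $0\le p<m\le n<q\le d$ with $m+n=p+q$. -/

import Mathlib

/-! Symmetric functions are formal power series over `ℚ` in the variables `x_0, x_1, x_2, …`
(so the colour `i : ℕ` stands for the positive integer `i + 1`). -/

namespace SpiderLC

noncomputable section

/-! ### Schur functions -/

open Classical in
/-- The elementary symmetric function `e_k`, for `k : ℤ`: the sum of all squarefree monomials of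
degree `k`. In particular `e_0 = 1` and `e_k = 0` for `k < 0`. -/
def elemSymm (k : ℤ) : MvPowerSeries ℕ ℚ :=
  fun a => if (∀ i, a i ≤ 1) ∧ (a.degree : ℤ) = k then 1 else 0

/-- The part `λ'_i = #{j | λ_j ≥ i}` (`i ≥ 1`) of the conjugate of a partition `λ`. -/
def conjPart {n : ℕ} (lam : n.Partition) (i : ℕ) : ℕ :=
  (lam.parts.filter (fun p => i ≤ p)).card

/-- The Schur function `s_λ`, by the dual Jacobi–Trudi identity
`s_λ = det (e_{λ'_i - i + j})`, `1 ≤ i, j ≤ ℓ(λ')`, where `ℓ(λ')` is the largest part of `λ`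
(and `0` if `λ` is empty). -/
def schur {n : ℕ} (lam : n.Partition) : MvPowerSeries ℕ ℚ :=
  (Matrix.of fun i j : Fin lam.parts.sup =>
    elemSymm ((conjPart lam (i + 1) : ℤ) - (i : ℤ) + (j : ℤ))).det

/-- `f = ∑_λ c_λ s_λ`, the sum being over all partitions of all `n`: since `s_λ` is homogeneous of
degree `|λ|`, this says that the degree `n` component of `f` is `∑_{λ ⊢ n} c_λ s_λ` for all `n`.
As the Schur functions are linearly independent, `f` has at most one such expansion, and `c_λ` is
the coefficient `[s_λ] f`. -/
def IsSchurExpansion (f : MvPowerSeries ℕ ℚ) (c : (n : ℕ) → n.Partition → ℚ) : Prop :=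
  ∀ n : ℕ, MvPowerSeries.homogeneousComponent n f = ∑ lam : n.Partition, c n lam • schur lam

/-- `f` is 2-Schur-positive: it has an expansion in Schur functions, and `[s_λ] f ≥ 0` for all
partitions `λ` of length at most two. -/
def IsTwoSchurPositive (f : MvPowerSeries ℕ ℚ) : Prop :=
  ∃ c : (n : ℕ) → n.Partition → ℚ, IsSchurExpansion f c ∧
    ∀ (n : ℕ) (lam : n.Partition), lam.parts.card ≤ 2 → 0 ≤ c n lam

/-! ### Multicolorings and the symmetric function `Y_G` -/

section Graph

variable {V : Type*} [Fintype V]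

/-- The proper multicolorings `κ` of `G` of type `α` such that every colour `i` is used at
exactly `a i` vertices. -/
def multicolorings (G : SimpleGraph V) (α : V → ℕ) (a : ℕ →₀ ℕ) : Set (V → Finset ℕ) :=
  {κ | (∀ v, (κ v).card = α v) ∧ (∀ u v, G.Adj u v → Disjoint (κ u) (κ v)) ∧
    ∀ i, (Finset.univ.filter (fun v => i ∈ κ v)).card = a i}

theorem multicolorings_subset_support {G : SimpleGraph V} {α : V → ℕ} {a : ℕ →₀ ℕ}
    {κ : V → Finset ℕ} (h : κ ∈ multicolorings G α a) (v : V) : κ v ⊆ a.support := by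
  intro i hi
  rw [Finsupp.mem_support_iff, ← h.2.2 i]
  exact Finset.card_ne_zero_of_mem (Finset.mem_filter.2 ⟨Finset.mem_univ v, hi⟩)

theorem multicolorings_finite (G : SimpleGraph V) (α : V → ℕ) (a : ℕ →₀ ℕ) :
    (multicolorings G α a).Finite := by
  classical
  refine (Finset.finite_toSet (Fintype.piFinset fun _ : V => a.support.powerset)).subset ?_
  intro κ h
  simpa using multicolorings_subset_support h

/-- Stanley's `X_G^α = ∑_κ x^κ`, over the proper multicolorings `κ` of `G` of type `α`. -/
def X (G : SimpleGraph V) (α : V → ℕ) : MvPowerSeries ℕ ℚ :=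
  fun a => ((multicolorings G α a).ncard : ℚ)

/-- Every monomial occurs in only finitely many of the `X_G^α`. -/
theorem X_coeff_support_finite (G : SimpleGraph V) (a : ℕ →₀ ℕ) :
    (Function.support fun α : V → ℕ => MvPowerSeries.coeff a (X G α)).Finite := by
  classical
  refine (Finset.finite_toSet
    (Fintype.piFinset fun _ : V => Finset.range (a.support.card + 1))).subset ?_
  intro α h
  have hne : ((multicolorings G α a).ncard : ℚ) ≠ 0 := h
  obtain ⟨κ, hκ⟩ := Set.nonempty_of_ncard_ne_zero (by exact_mod_cast hne)
  simp only [Finset.mem_coe, Fintype.mem_piFinset, Finset.mem_range]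
  intro v
  rw [← hκ.1 v]
  exact Nat.lt_succ_of_le (Finset.card_le_card (multicolorings_subset_support hκ v))

/-- `Y_G = ∑_α X_G^α`, the formal sum over all maps `α : V → ℕ`; coefficientwise it is a finite
sum by `X_coeff_support_finite`. -/
def Y (G : SimpleGraph V) : MvPowerSeries ℕ ℚ :=
  fun a => ∑ᶠ α : V → ℕ, MvPowerSeries.coeff a (X G α)

/-! ### Independence polynomials -/

/-- The independence polynomial `I_G(t) = ∑_j i_j t^j`, where `i_j` is the number of independent
sets of cardinality `j`, and `j` runs up to the independence number. -/
def indepPoly (G : SimpleGraph V) : Polynomial ℚ :=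
  ∑ j ∈ Finset.range (G.indepNum + 1),
    Polynomial.monomial j ({s : Finset V | G.IsNIndepSet j s}.ncard : ℚ)

end Graph

/-- `a_0 + a_1 t + ⋯ + a_d t^d` is strongly log-concave: `a_m a_n ≥ a_p a_q` whenever
`0 ≤ p < m ≤ n < q ≤ d` and `m + n = p + q`. -/
def IsStronglyLogConcave (P : Polynomial ℚ) : Prop :=
  ∀ p m n q : ℕ, p < m → m ≤ n → n < q → q ≤ P.natDegree → m + n = p + q →
    P.coeff p * P.coeff q ≤ P.coeff m * P.coeff n

/-! ### Spiders -/

/-- The vertices of the spider with leg lengths `L`: the torso `none`, and the `j`-th vertex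
`some ⟨i, j⟩` of the `i`-th leg (counted from the torso, starting with `j = 0`). -/
abbrev SpiderVertex (L : List ℕ) : Type := Option (Σ i : Fin L.length, Fin (L.get i))

/-- The edges of the spider, directed away from the torso. -/
def spiderArc (L : List ℕ) : SpiderVertex L → SpiderVertex L → Prop
  | none, some v => (v.2 : ℕ) = 0
  | some u, some v => u.1 = v.1 ∧ (v.2 : ℕ) = (u.2 : ℕ) + 1
  | _, none => False

/-- A torso with a path of `L[i]` further vertices attached to it for every `i`. -/
def spiderOfList (L : List ℕ) : SimpleGraph (SpiderVertex L) :=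
  SimpleGraph.fromRel (spiderArc L)

/-- The parts of a partition in weakly decreasing order. -/
def partsList {n : ℕ} (lam : n.Partition) : List ℕ := lam.parts.sort (· ≥ ·)

/-- The spider `S(λ)`, whose leg lengths are the parts of the partition `λ`. -/
def spider {n : ℕ} (lam : n.Partition) : SimpleGraph (SpiderVertex (partsList lam)) :=
  spiderOfList (partsList lam)

end

end SpiderLC

set_option linter.unusedSimpArgs false

namespace SpiderLC

/-! ### The cone of Schur-positive polynomials in two variables -/

section Cone

variable {R : Type*} [CommRing R] (e₁ e₂ : R)

/-! Put e₁ = x + y, e₂ = xy. In two variables the nonzero Schur functions are e₂^b h_n, and the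
coefficient of s_(p,r) in I(x)I(y) is i_p i_r - i_{p+1} i_{r-1}. So both claims follow once I(x)I(y)
lies in `schurCone`, the cone spanned by the e₂^b h_n. Below, f ≥ f' means that f - f' lies in this
cone.

For a spider, I(t) = ∏ Q_{k+1}(t) + t ∏ Q_k(t) over the leg lengths k, with Q the Fibonacci
polynomials. For k = m + 1, Q_{m+2}(x)Q_{m+1}(y) = σ + xB and Q_{m+2}(x)Q_{m+2}(y) = σ + g with σ,
B, g in ℕ[e₁, e₂] (B is `legSkew`, g is `legGain`). Expanding over the set K of legs that do not
contribute σ leaves ∏ g + (y x^|K| + x y^|K|) ∏ B. Negative terms occur only for |K| = n + 3, where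
x^{n+2} + y^{n+2} = h_{n+2} - e₂ h_n; it suffices that ∏ g ≥ e₂² h_n ∏ B (`prod_legGain_sub_mem`).

Since g ≥ e₁B and e₁h_n ≥ h_{n+1}, that reduces to three legs. The three-leg statement is trilinear
in the vectors (B, g), and those of legs with evenly many vertices are nonnegative combinations of
those of odd legs and (0, 1). Odd legs are handled by `legGain_mul_legGain_sub_mem` and
`two_mul_legSkew_le`.

For Y, the coefficient of x^a is ∏ i_{a_j}. Each degree of Y is therefore symmetric and has a Schur
expansion; setting all but two variables to zero turns Y into I(x)I(y) and kills exactly the Schur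
functions of length above 2. -/

/-- The complete homogeneous symmetric polynomials in two variables with elementary symmetric
polynomials `e₁` and `e₂`. -/
def hsym : ℕ → R
  | 0 => 1
  | 1 => e₁
  | n + 2 => e₁ * hsym (n + 1) - e₂ * hsym n

/-- Polynomials in `e₁` and `e₂` with coefficients in `ℕ`. -/
def elemPos : Subsemiring R := Subsemiring.closure {e₁, e₂}

/-- Nonnegative combinations of the two-variable Schur functions `e₂ ^ b * h_n`. -/
def schurCone : AddSubmonoid R :=
  AddSubmonoid.closure {f | ∃ b n : ℕ, f = e₂ ^ b * hsym e₁ e₂ n}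

theorem e₁_mem : e₁ ∈ elemPos e₁ e₂ := Subsemiring.subset_closure (by simp)

theorem e₂_mem : e₂ ∈ elemPos e₁ e₂ := Subsemiring.subset_closure (by simp)

variable {e₁ e₂}

theorem pow_mul_hsym_mem (b n : ℕ) : e₂ ^ b * hsym e₁ e₂ n ∈ schurCone e₁ e₂ :=
  AddSubmonoid.subset_closure ⟨b, n, rfl⟩

theorem hsym_mem (n : ℕ) : hsym e₁ e₂ n ∈ schurCone e₁ e₂ := by
  simpa using pow_mul_hsym_mem (e₁ := e₁) (e₂ := e₂) 0 n

/-- Pieri rule: e₁ h_{n+1} = h_{n+2} + e₂ h_n, while e₂ merely raises the exponent b. -/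
theorem mul_mem_schurCone {s f : R} (hs : s ∈ elemPos e₁ e₂) (hf : f ∈ schurCone e₁ e₂) :
    s * f ∈ schurCone e₁ e₂ := by
  induction hs using Subsemiring.closure_induction generalizing f with
  | mem s hs =>
    induction hf using AddSubmonoid.closure_induction with
    | mem f hf =>
      obtain ⟨b, n, rfl⟩ := hf
      rcases hs with rfl | rfl
      · match n with
        | 0 => simpa [hsym, mul_comm] using pow_mul_hsym_mem (e₁ := s) (e₂ := e₂) b 1
        | n + 1 =>
          have : s * (e₂ ^ b * hsym s e₂ (n + 1)) =
              e₂ ^ b * hsym s e₂ (n + 2) + e₂ ^ (b + 1) * hsym s e₂ n := by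
            simp only [hsym]; ring
          rw [this]
          exact add_mem (pow_mul_hsym_mem _ _) (pow_mul_hsym_mem _ _)
      · have := pow_mul_hsym_mem (e₁ := e₁) (e₂ := s) (b + 1) n
        rwa [pow_succ', mul_assoc] at this
    | zero => simp
    | add f g _ _ hf hg => rw [mul_add]; exact add_mem hf hg
  | zero => simp
  | one => simpa using hf
  | add s t _ _ hs ht => rw [add_mul]; exact add_mem (hs hf) (ht hf)
  | mul s t _ _ hs ht => rw [mul_assoc]; exact hs (ht hf)

theorem mem_schurCone_of_mem {s : R} (hs : s ∈ elemPos e₁ e₂) : s ∈ schurCone e₁ e₂ := by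
  simpa [hsym] using mul_mem_schurCone hs (hsym_mem 0)

theorem two_mem_elemPos : (2 : R) ∈ elemPos e₁ e₂ := ofNat_mem _ 2

end Cone

/-! ### The bilinear Fibonacci recursion of a path -/

section Paths

variable {R : Type*} [CommRing R] (e₁ e₂ : R)

/-- The values `(q_k, q_{k+1}, B_k, B_{k+1})`. -/
def legState : ℕ → R × R × R × R
  | 0 => (1, 1, 0, 1)
  | k + 1 =>
    ((legState k).2.1,
      (legState k).2.1 + e₁ * (legState k).2.2.2 + 2 * e₂ * (legState k).2.2.1 +
        e₂ * (legState k).1,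
      (legState k).2.2.2, (legState k).2.1 + e₂ * (legState k).2.2.1)

/-- `q_k = Q_k(x) Q_k(y)`, where `Q_k` is the `k`-th Fibonacci polynomial. -/
def legDiag (k : ℕ) : R := (legState e₁ e₂ k).1

/-- `B_k = (Q_{k+1}(x) Q_k(y) - Q_k(x) Q_{k+1}(y)) / (x - y)`. -/
def legSkew (k : ℕ) : R := (legState e₁ e₂ k).2.2.1

local notation "q" => legDiag e₁ e₂
local notation "B" => legSkew e₁ e₂

@[simp] theorem legDiag_zero : q 0 = 1 := rfl
@[simp] theorem legDiag_one : q 1 = 1 := rfl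
@[simp] theorem legSkew_zero : B 0 = 0 := rfl
@[simp] theorem legSkew_one : B 1 = 1 := rfl

theorem legDiag_add_two (k : ℕ) :
    q (k + 2) = q (k + 1) + e₁ * B (k + 1) + 2 * e₂ * B k + e₂ * q k := rfl

theorem legSkew_add_two (k : ℕ) : B (k + 2) = q (k + 1) + e₂ * B k := rfl

/-- The part of `q_{k+2}` that is left after removing the symmetric part of
`Q_{k+2}(x) Q_{k+1}(y)`. -/
def legGain (k : ℕ) : R := e₁ * B (k + 1) + e₂ * B k + e₂ * q k

local notation "g" => legGain e₁ e₂

theorem legDiag_mem_and_legSkew_mem (k : ℕ) :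
    q k ∈ elemPos e₁ e₂ ∧ B k ∈ elemPos e₁ e₂ ∧ q (k + 1) ∈ elemPos e₁ e₂ ∧
      B (k + 1) ∈ elemPos e₁ e₂ := by
  have h1 := e₁_mem e₁ e₂
  have h2 := e₂_mem e₁ e₂
  have h3 : (2 : R) ∈ elemPos e₁ e₂ := two_mem_elemPos
  induction k with
  | zero => simp
  | succ k ih =>
    obtain ⟨a, b, c, d⟩ := ih
    refine ⟨c, d, ?_, ?_⟩
    · rw [legDiag_add_two]
      simp (maxDischargeDepth := 20) [add_mem, mul_mem, h1, h2, h3, a, b, c, d]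
    · rw [legSkew_add_two]
      simp (maxDischargeDepth := 20) [add_mem, mul_mem, h1, h2, h3, a, b, c, d]

theorem legDiag_mem (k : ℕ) : q k ∈ elemPos e₁ e₂ := (legDiag_mem_and_legSkew_mem e₁ e₂ k).1

theorem legSkew_mem (k : ℕ) : B k ∈ elemPos e₁ e₂ := (legDiag_mem_and_legSkew_mem e₁ e₂ k).2.1

theorem legGain_mem (k : ℕ) : g k ∈ elemPos e₁ e₂ := by
  have h1 := e₁_mem e₁ e₂
  have h2 := e₂_mem e₁ e₂
  have h3 := legDiag_mem e₁ e₂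
  have h4 := legSkew_mem e₁ e₂
  unfold legGain
  simp (maxDischargeDepth := 20) [add_mem, mul_mem, h1, h2, h3, h4]

theorem legDiag_succ_sub_mem (k : ℕ) : q (k + 1) - q k ∈ elemPos e₁ e₂ := by
  have h1 := e₁_mem e₁ e₂
  have h2 := e₂_mem e₁ e₂
  have h3 := legDiag_mem e₁ e₂
  have h4 := legSkew_mem e₁ e₂
  have h5 : (2 : R) ∈ elemPos e₁ e₂ := two_mem_elemPos
  match k with
  | 0 => simp
  | k + 1 =>
    have : q (k + 1 + 1) - q (k + 1) = e₁ * B (k + 1) + 2 * e₂ * B k + e₂ * q k := by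
      rw [legDiag_add_two]; ring
    rw [this]
    simp (maxDischargeDepth := 20) [add_mem, mul_mem, h1, h2, h3, h4, h5]

theorem legSkew_succ_sub_mem (k : ℕ) :
    B (k + 1) - B k ∈ elemPos e₁ e₂ ∧ B (k + 2) - B (k + 1) ∈ elemPos e₁ e₂ := by
  have h2 := e₂_mem e₁ e₂
  induction k with
  | zero => simp [legSkew_add_two]
  | succ k ih =>
    refine ⟨ih.2, ?_⟩
    have : B (k + 1 + 2) - B (k + 1 + 1) =
        (q (k + 1 + 1) - q (k + 1)) + e₂ * (B (k + 1) - B k) := by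
      rw [legSkew_add_two, legSkew_add_two]; ring
    rw [this]
    exact add_mem (legDiag_succ_sub_mem e₁ e₂ _) (mul_mem h2 ih.1)

theorem legDiag_sub_mul_legSkew_mem (k : ℕ) : q (k + 1) - e₁ * B k ∈ elemPos e₁ e₂ := by
  have h2 := e₂_mem e₁ e₂
  have h3 := legDiag_mem e₁ e₂
  have h4 := legSkew_mem e₁ e₂
  have h5 : (2 : R) ∈ elemPos e₁ e₂ := two_mem_elemPos
  match k with
  | 0 => simp
  | k + 1 =>
    have : q (k + 1 + 1) - e₁ * B (k + 1) = q (k + 1) + 2 * e₂ * B k + e₂ * q k := by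
      rw [legDiag_add_two]; ring
    rw [this]
    simp (maxDischargeDepth := 20) [add_mem, mul_mem, h2, h3, h4, h5]

/-- Raising both indices by one multiplies the expression by e₂, so everything reduces to an index
0, where it is 0 or e₂ times some q. -/
theorem legPair_mem (i j : ℕ) :
    q (i + 1) * q j + q (j + 1) * q i - 2 * B (i + 1) * B (j + 1) - 2 * e₂ * B i * B j -
      e₁ * (B i * B (j + 1) + B j * B (i + 1)) ∈ elemPos e₁ e₂ := by
  have h2 := e₂_mem e₁ e₂
  have h3 := legDiag_mem e₁ e₂
  induction i generalizing j with
  | zero =>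
    match j with
    | 0 =>
      convert zero_mem (elemPos e₁ e₂) using 1
      simp; ring
    | j + 1 =>
      convert mul_mem h2 (h3 j) using 1
      rw [legDiag_add_two, legSkew_add_two]
      simp; ring
  | succ i ih =>
    match j with
    | 0 =>
      convert mul_mem h2 (h3 i) using 1
      rw [legDiag_add_two, legSkew_add_two]
      simp; ring
    | j + 1 =>
      convert mul_mem h2 (ih j) using 1
      simp only [legDiag_add_two, legSkew_add_two]
      ring

/-- This is h_2. The path inequalities below reduce to nonnegative polynomials in e₁, e₂ and
multiples of it. -/
theorem sq_sub_mem : e₁ * e₁ - e₂ ∈ schurCone e₁ e₂ := by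
  simpa [hsym] using hsym_mem (e₁ := e₁) (e₂ := e₂) 2

theorem two_mul_legSkew_le (i j : ℕ) :
    q (i + 1) * q j + q (j + 1) * q i - 2 * B (i + 1) * B (j + 1) ∈ elemPos e₁ e₂ := by
  have h1 := e₁_mem e₁ e₂
  have h2 := e₂_mem e₁ e₂
  have h4 := legSkew_mem e₁ e₂
  have h5 : (2 : R) ∈ elemPos e₁ e₂ := two_mem_elemPos
  have : q (i + 1) * q j + q (j + 1) * q i - 2 * B (i + 1) * B (j + 1) =
      (q (i + 1) * q j + q (j + 1) * q i - 2 * B (i + 1) * B (j + 1) - 2 * e₂ * B i * B j -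
      e₁ * (B i * B (j + 1) + B j * B (i + 1))) + (2 * e₂ * B i * B j +
      e₁ * (B i * B (j + 1) + B j * B (i + 1))) := by ring
  rw [this]
  refine add_mem (legPair_mem e₁ e₂ i j) ?_
  simp (maxDischargeDepth := 20) [add_mem, mul_mem, h1, h2, h4, h5]

/-- The critical term in the induction for `legGain_mul_legGain_sub_mem`. -/
theorem legSkew_mul_legSkew_le (l k : ℕ) :
    (B l + q l) * (q (k + 1) + e₂ * B k) + e₁ * (B l + q l) * B (k + 1) -
      B (l + 1) * B (k + 1) ∈ schurCone e₁ e₂ := by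
  have h1 := e₁_mem e₁ e₂
  have h2 := e₂_mem e₁ e₂
  have h3 := legDiag_mem e₁ e₂
  have h4 := legSkew_mem e₁ e₂
  have mono : q (k + 1) + e₂ * B k - B (k + 1) ∈ elemPos e₁ e₂ :=
    (legSkew_succ_sub_mem e₁ e₂ k).2
  match l with
  | 0 =>
    have : (B 0 + q 0) * (q (k + 1) + e₂ * B k) + e₁ * (B 0 + q 0) * B (k + 1) -
        B (0 + 1) * B (k + 1) = (q (k + 1) + e₂ * B k - B (k + 1)) + e₁ * B (k + 1) := by
      simp; ring
    rw [this]
    exact mem_schurCone_of_mem (add_mem mono (mul_mem h1 (h4 _)))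
  | l + 1 =>
    -- Split B_{l+2} = q_{l+1} + e₂ B_l. Growth of B pays for the first part; for the second,
    -- q_{l+1} ≥ e₁ B_l provides e₁² B_l B_{k+1}, which beats e₂ B_l B_{k+1} by a multiple of h_2.
    have : (B (l + 1) + q (l + 1)) * (q (k + 1) + e₂ * B k) +
        e₁ * (B (l + 1) + q (l + 1)) * B (k + 1) - B (l + 1 + 1) * B (k + 1) =
        (B (l + 1) * (q (k + 1) + e₂ * B k) + e₁ * B (l + 1) * B (k + 1) +
          q (l + 1) * (q (k + 1) + e₂ * B k - B (k + 1)) +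
          e₁ * B (k + 1) * (q (l + 1) - e₁ * B l)) +
        (B (k + 1) * B l) * (e₁ * e₁ - e₂) := by
      rw [legSkew_add_two]; ring
    rw [this]
    refine add_mem (mem_schurCone_of_mem ?_)
      (mul_mem_schurCone (mul_mem (h4 _) (h4 _)) (sq_sub_mem _ _))
    have h5 := legDiag_sub_mul_legSkew_mem e₁ e₂ l
    refine add_mem (add_mem (add_mem ?_ ?_) (mul_mem (h3 _) mono)) (mul_mem ?_ h5)
    all_goals simp (maxDischargeDepth := 20) [add_mem, mul_mem, h1, h2, h3, h4]

theorem legGain_mul_legGain_sub_mem (l r : ℕ) :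
    g l * g (2 * r) - e₂ * B (l + 1) * q (2 * r + 1) ∈ schurCone e₁ e₂ := by
  have h1 := e₁_mem e₁ e₂
  have h2 := e₂_mem e₁ e₂
  have h3 := legDiag_mem e₁ e₂
  have h4 := legSkew_mem e₁ e₂
  have h5 : (2 : R) ∈ elemPos e₁ e₂ := two_mem_elemPos
  have h6 := sq_sub_mem e₁ e₂
  induction r with
  | zero =>
    have : g l * g (2 * 0) - e₂ * B (l + 1) * q (2 * 0 + 1) =
        B (l + 1) * (e₁ * e₁ - e₂) +
          (e₁ * e₂ * B (l + 1) + (e₁ + e₂) * (e₂ * B l + e₂ * q l)) := by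
      simp [legGain]; ring
    rw [this]
    refine add_mem (mul_mem_schurCone (h4 _) h6) (mem_schurCone_of_mem ?_)
    simp (maxDischargeDepth := 20) [add_mem, mul_mem, h1, h2, h3, h4, h5, h6]
  | succ r ih =>
    have h7 := legSkew_mul_legSkew_le e₁ e₂ l (2 * r)
    have e : 2 * (r + 1) = 2 * r + 2 := by ring
    -- The recursion descends by two and holds for every k; the even index comes from the base case
    -- k = 0.
    have key (k : ℕ) : g l * g (k + 2) - e₂ * B (l + 1) * q (k + 2 + 1) =
        e₂ * (g l * g k - e₂ * B (l + 1) * q (k + 1)) +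
        (e₂ * e₂) * ((B l + q l) * (q (k + 1) + e₂ * B k) + e₁ * (B l + q l) * B (k + 1) -
          B (l + 1) * B (k + 1)) +
        (B (l + 1) * (q (k + 2) + e₂ * B (k + 1))) * (e₁ * e₁ - e₂) +
        (e₁ * e₂ * B (l + 1) * q (k + 1) + e₁ * e₂ * e₂ * B (l + 1) * B k +
          e₂ * (B l + q l) * (e₁ * q (k + 2) + e₂ * q (k + 1) + e₂ * e₂ * B k)) := by
      simp only [legGain, legDiag_add_two e₁ e₂ (k + 1), legSkew_add_two,
        legDiag_add_two e₁ e₂ k]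
      ring
    rw [e]
    generalize 2 * r = k at ih h7 ⊢
    rw [key]
    refine add_mem (add_mem (add_mem (mul_mem_schurCone h2 ih)
      (mul_mem_schurCone (mul_mem h2 h2) h7)) (mul_mem_schurCone ?_ h6)) (mem_schurCone_of_mem ?_)
    all_goals simp (maxDischargeDepth := 20) [add_mem, mul_mem, h1, h2, h3, h4, h5]

end Paths

/-! ### Legs as vectors, and the inequality for three or more legs. -/

section Legs

variable {R : Type*} [CommRing R] (e₁ e₂ : R)

local notation "q" => legDiag e₁ e₂
local notation "B" => legSkew e₁ e₂
local notation "g" => legGain e₁ e₂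

/-- The skew part and the gain of a leg with `k + 1` vertices. -/
def legVec (k : ℕ) : R × R := (B (k + 1), g k)

/-- The combinations of the vectors of legs with an odd number of vertices, up to gains. -/
def legCone : Submodule (elemPos e₁ e₂) (R × R) :=
  Submodule.span _ ({u | ∃ r : ℕ, u = legVec e₁ e₂ (2 * r)} ∪ {(0, 1)})

theorem mul_mem_legCone {s : R} (hs : s ∈ elemPos e₁ e₂) {u : R × R} (hu : u ∈ legCone e₁ e₂) :
    (s * u.1, s * u.2) ∈ legCone e₁ e₂ :=
  (legCone e₁ e₂).smul_mem ⟨s, hs⟩ hu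

theorem gain_mem_legCone {s : R} (hs : s ∈ elemPos e₁ e₂) : ((0, s) : R × R) ∈ legCone e₁ e₂ := by
  have : ((0, 1) : R × R) ∈ legCone e₁ e₂ := Submodule.subset_span (by simp)
  simpa using mul_mem_legCone e₁ e₂ hs this

theorem legVec_even_mem (r : ℕ) : legVec e₁ e₂ (2 * r) ∈ legCone e₁ e₂ :=
  Submodule.subset_span (Or.inl ⟨r, rfl⟩)

/-- Let v_k be the leg vectors. The second claim concerns z_r = v_{2r+3} - v_{2r+2} - e₂ v_{2r+1},
which carries v_{2r+1} to v_{2r+3}; the induction closes because z_{r+1} = e₁ v_{2r+3} + 2e₂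
v_{2r+2} + e₂ z_r. -/
theorem legVec_odd_mem (r : ℕ) :
    legVec e₁ e₂ (2 * r + 1) ∈ legCone e₁ e₂ ∧
      (B (2 * r + 4) - B (2 * r + 3) - e₂ * B (2 * r + 2),
        g (2 * r + 3) - g (2 * r + 2) - e₂ * g (2 * r + 1)) ∈ legCone e₁ e₂ := by
  have h1 := e₁_mem e₁ e₂
  have h2 := e₂_mem e₁ e₂
  have h5 : (2 : R) ∈ elemPos e₁ e₂ := two_mem_elemPos
  induction r with
  | zero =>
    have hv : legVec e₁ e₂ (2 * 0 + 1) ∈ legCone e₁ e₂ := by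
      have : legVec e₁ e₂ (2 * 0 + 1) = legVec e₁ e₂ (2 * 0) + (0, e₂) := by
        ext
        · simp [legVec, legSkew_add_two]
        · simp [legVec, legGain, legSkew_add_two]
      rw [this]
      exact add_mem (legVec_even_mem _ _ _) (gain_mem_legCone _ _ h2)
    refine ⟨hv, ?_⟩
    have h := add_mem (add_mem (mul_mem_legCone e₁ e₂ h1 hv)
      (mul_mem_legCone e₁ e₂ (mul_mem h5 h2) (legVec_even_mem e₁ e₂ 0)))
      (gain_mem_legCone e₁ e₂ (mul_mem h2 h2))
    convert h using 1
    ext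
    · simp [legVec, legSkew_add_two, legDiag_add_two]; ring
    · simp [legVec, legGain, legSkew_add_two, legDiag_add_two]; ring
  | succ r ih =>
    obtain ⟨hv, hz⟩ := ih
    have he := legVec_even_mem e₁ e₂ (r + 1)
    have e : 2 * (r + 1) = 2 * r + 2 := by ring
    rw [e] at he ⊢
    generalize 2 * r = k at *
    have hv' : legVec e₁ e₂ (k + 2 + 1) ∈ legCone e₁ e₂ := by
      convert add_mem (add_mem he (mul_mem_legCone e₁ e₂ h2 hv)) hz using 1
      ext
      · simp [legVec]
      · simp [legVec]
    refine ⟨hv', ?_⟩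
    convert add_mem (add_mem (mul_mem_legCone e₁ e₂ h1 hv')
      (mul_mem_legCone e₁ e₂ (mul_mem h5 h2) he)) (mul_mem_legCone e₁ e₂ h2 hz) using 1
    ext
    · simp only [legVec, legSkew_add_two, legDiag_add_two, Prod.fst_add]; ring
    · simp only [legVec, legGain, legSkew_add_two, legDiag_add_two, Prod.snd_add]; ring

theorem legVec_mem (k : ℕ) : legVec e₁ e₂ k ∈ legCone e₁ e₂ := by
  rcases Nat.even_or_odd' k with ⟨r, rfl | rfl⟩
  · exact legVec_even_mem e₁ e₂ r
  · exact (legVec_odd_mem e₁ e₂ r).1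

theorem elemPos_of_mem_legCone {u : R × R} (hu : u ∈ legCone e₁ e₂) :
    u.1 ∈ elemPos e₁ e₂ ∧ u.2 ∈ elemPos e₁ e₂ := by
  induction hu using Submodule.span_induction with
  | mem u hu =>
    rcases hu with ⟨r, rfl⟩ | rfl
    · exact ⟨legSkew_mem _ _ _, legGain_mem _ _ _⟩
    · simp
  | zero => simp
  | add u v _ _ hu hv => exact ⟨add_mem hu.1 hv.1, add_mem hu.2 hv.2⟩
  | smul s u _ hu => exact ⟨mul_mem s.2 hu.1, mul_mem s.2 hu.2⟩

/-- Splitting e₂q off g_j in one copy of the product and off g_i in the other,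
`legGain_mul_legGain_sub_mem` yields e₂² B_{l+1} (q_{i+1} q_j + q_{j+1} q_i), and
`two_mul_legSkew_le` finishes. This symmetrization is the origin of the factor 2. -/
theorem legVec_triple_even (i j l : ℕ) :
    2 * (g (2 * i) * g (2 * j) * g l -
      e₂ ^ 2 * (B (2 * i + 1) * B (2 * j + 1) * B (l + 1))) ∈ schurCone e₁ e₂ := by
  have h1 := e₁_mem e₁ e₂
  have h2 := e₂_mem e₁ e₂
  have h3 := legDiag_mem e₁ e₂
  have h4 := legSkew_mem e₁ e₂
  have h5 := legGain_mem e₁ e₂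
  have k1 := legGain_mul_legGain_sub_mem e₁ e₂ l i
  have k2 := legGain_mul_legGain_sub_mem e₁ e₂ l j
  generalize 2 * i = i at *
  generalize 2 * j = j at *
  have key : 2 * (g i * g j * g l - e₂ ^ 2 * (B (i + 1) * B (j + 1) * B (l + 1))) =
      (e₂ * e₂ * B (l + 1) *
        (q (i + 1) * q j + q (j + 1) * q i - 2 * B (i + 1) * B (j + 1)) +
        g l * g i * (e₁ * B (j + 1) + e₂ * B j) + g l * g j * (e₁ * B (i + 1) + e₂ * B i)) +
      ((e₂ * q j) * (g l * g i - e₂ * B (l + 1) * q (i + 1)) +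
      (e₂ * q i) * (g l * g j - e₂ * B (l + 1) * q (j + 1))) := by
    have hi : e₁ * B (i + 1) + e₂ * B i = g i - e₂ * q i := by simp only [legGain]; ring
    have hj : e₁ * B (j + 1) + e₂ * B j = g j - e₂ * q j := by simp only [legGain]; ring
    rw [hi, hj]; ring
  rw [key]
  refine add_mem (mem_schurCone_of_mem ?_)
    (add_mem (mul_mem_schurCone (mul_mem h2 (h3 _)) k1) (mul_mem_schurCone (mul_mem h2 (h3 _)) k2))
  have := two_mul_legSkew_le e₁ e₂ i j
  simp (maxDischargeDepth := 20) [add_mem, mul_mem, h1, h2, h3, h4, h5, this]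

/-- By linearity in each vector it suffices to check generators. If one of them is (0, 1), the
subtracted product vanishes and a nonnegative one remains. -/
theorem legCone_triple {u v w : R × R} (hu : u ∈ legCone e₁ e₂) (hv : v ∈ legCone e₁ e₂)
    (hw : w ∈ legCone e₁ e₂) :
    2 * (u.2 * v.2 * w.2 - e₂ ^ 2 * (u.1 * v.1 * w.1)) ∈ schurCone e₁ e₂ := by
  have h5 : (2 : R) ∈ elemPos e₁ e₂ := two_mem_elemPos
  have hv' := elemPos_of_mem_legCone e₁ e₂ hv
  have hw' := elemPos_of_mem_legCone e₁ e₂ hw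
  induction hu using Submodule.span_induction with
  | mem u hu =>
    rcases hu with ⟨i, rfl⟩ | rfl
    · induction hv using Submodule.span_induction with
      | mem v hv =>
        rcases hv with ⟨j, rfl⟩ | rfl
        · induction hw using Submodule.span_induction with
          | mem w hw =>
            rcases hw with ⟨l, rfl⟩ | rfl
            · exact legVec_triple_even e₁ e₂ i j (2 * l)
            · apply mem_schurCone_of_mem
              simp (maxDischargeDepth := 20) [legVec, mul_mem, h5, legGain_mem]
          | zero => simp
          | add w w' hm hm' h h' =>
            convert add_mem (h (elemPos_of_mem_legCone e₁ e₂ hm))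
              (h' (elemPos_of_mem_legCone e₁ e₂ hm')) using 1
            simp only [Prod.fst_add, Prod.snd_add]; ring
          | smul s w hm h =>
            convert mul_mem_schurCone s.2 (h (elemPos_of_mem_legCone e₁ e₂ hm)) using 1
            simp only [Prod.smul_fst, Prod.smul_snd, Subsemiring.smul_def, smul_eq_mul]; ring
        · apply mem_schurCone_of_mem
          simp (maxDischargeDepth := 20) [legVec, mul_mem, h5, legGain_mem, hw']
      | zero => simp
      | add w w' hm hm' h h' =>
        convert add_mem (h (elemPos_of_mem_legCone e₁ e₂ hm))
          (h' (elemPos_of_mem_legCone e₁ e₂ hm')) using 1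
        simp only [Prod.fst_add, Prod.snd_add]; ring
      | smul s w hm h =>
        convert mul_mem_schurCone s.2 (h (elemPos_of_mem_legCone e₁ e₂ hm)) using 1
        simp only [Prod.smul_fst, Prod.smul_snd, Subsemiring.smul_def, smul_eq_mul]; ring
    · apply mem_schurCone_of_mem
      simp (maxDischargeDepth := 20) [mul_mem, h5, hv', hw']
  | zero => simp
  | add w w' hm hm' h h' =>
    convert add_mem h h' using 1
    simp only [Prod.fst_add, Prod.snd_add]; ring
  | smul s w hm h =>
    convert mul_mem_schurCone s.2 h using 1
    simp only [Prod.smul_fst, Prod.smul_snd, Subsemiring.smul_def, smul_eq_mul]; ring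

theorem mul_hsym_sub_mem (n : ℕ) : e₁ * hsym e₁ e₂ n - hsym e₁ e₂ (n + 1) ∈ schurCone e₁ e₂ := by
  match n with
  | 0 => simp [hsym]
  | n + 1 =>
    convert mul_mem_schurCone (e₂_mem e₁ e₂) (hsym_mem n) using 1
    simp only [hsym]; ring

open Finset in
-- Adding a leg multiplies the left product by g ≥ e₁ B, and e₁ h_n ≥ h_{n+1} supplies the next h;
-- the base case is three legs.
theorem prod_legGain_sub_mem {ι : Type*} [DecidableEq ι] (k : ι → ℕ) (K : Finset ι) (n : ℕ)
    (hK : #K = n + 3) :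
    2 * (∏ i ∈ K, g (k i) - e₂ ^ 2 * hsym e₁ e₂ n * ∏ i ∈ K, B (k i + 1)) ∈ schurCone e₁ e₂ := by
  have h1 := e₁_mem e₁ e₂
  have h2 := e₂_mem e₁ e₂
  have h5 : (2 : R) ∈ elemPos e₁ e₂ := two_mem_elemPos
  induction n generalizing K with
  | zero =>
    obtain ⟨a, b, c, hab, hac, hbc, rfl⟩ := card_eq_three.1 hK
    have := legCone_triple e₁ e₂ (legVec_mem e₁ e₂ (k a)) (legVec_mem e₁ e₂ (k b))
      (legVec_mem e₁ e₂ (k c))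
    convert this using 2
    rw [prod_insert (by simp [hab, hac]), prod_insert (by simp [hbc]), prod_singleton,
      prod_insert (by simp [hab, hac]), prod_insert (by simp [hbc]), prod_singleton]
    simp only [hsym, legVec]
    ring
  | succ n ih =>
    obtain ⟨i, hi⟩ : K.Nonempty := card_pos.1 (by lia)
    obtain ⟨K, hiK, rfl⟩ : ∃ K', i ∉ K' ∧ K = insert i K' :=
      ⟨K.erase i, notMem_erase _ _, (insert_erase hi).symm⟩
    rw [card_insert_of_notMem hiK] at hK
    have hB : ∏ i ∈ K, B (k i + 1) ∈ elemPos e₁ e₂ := prod_mem fun i _ => legSkew_mem _ _ _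
    have hg : ∏ i ∈ K, g (k i) ∈ elemPos e₁ e₂ := prod_mem fun i _ => legGain_mem _ _ _
    rw [prod_insert hiK, prod_insert hiK]
    have h3 := legDiag_mem e₁ e₂ (k i)
    have h4 := legSkew_mem e₁ e₂ (k i)
    have h4' := legSkew_mem e₁ e₂ (k i + 1)
    have key : 2 * (g (k i) * ∏ i ∈ K, g (k i) -
        e₂ ^ 2 * hsym e₁ e₂ (n + 1) * (B (k i + 1) * ∏ i ∈ K, B (k i + 1))) =
        2 * (e₂ * B (k i) + e₂ * q (k i)) * ∏ i ∈ K, g (k i) +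
        e₁ * B (k i + 1) *
          (2 * (∏ i ∈ K, g (k i) - e₂ ^ 2 * hsym e₁ e₂ n * ∏ i ∈ K, B (k i + 1))) +
        (2 * (e₂ * e₂) * B (k i + 1) * ∏ i ∈ K, B (k i + 1)) *
          (e₁ * hsym e₁ e₂ n - hsym e₁ e₂ (n + 1)) := by
      generalize ∏ i ∈ K, g (k i) = G
      simp only [legGain]; ring
    rw [key]
    refine add_mem (add_mem (mem_schurCone_of_mem ?_)
      (mul_mem_schurCone ?_ (ih K (by lia)))) (mul_mem_schurCone ?_ (mul_hsym_sub_mem _ _ _))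
    all_goals simp (maxDischargeDepth := 20) [add_mem, mul_mem, *]

end Legs

/-! ### Fibonacci polynomials and the product I(x)I(y) of a spider. -/

section Spider

variable {R : Type*} [CommRing R] (x y : R)

theorem pow_add_pow_eq_hsym (k : ℕ) :
    x ^ (k + 2) + y ^ (k + 2) = hsym (x + y) (x * y) (k + 2) - x * y * hsym (x + y) (x * y) k := by
  induction k using Nat.twoStepInduction with
  | zero => simp [hsym]; ring
  | one => simp [hsym]; ring
  | more k h1 h2 =>
    have e : x ^ (k + 2 + 2) + y ^ (k + 2 + 2) = (x + y) * (x ^ (k + 1 + 2) + y ^ (k + 1 + 2)) -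
      x * y * (x ^ (k + 2) + y ^ (k + 2)) := by ring
    rw [e, h1, h2]
    simp only [hsym]; ring

open Finset in
/-- The contribution of a set `K` of legs. -/
theorem prod_legGain_add_mem {ι : Type*} [DecidableEq ι] (k : ι → ℕ) (K : Finset ι) :
    2 * (∏ i ∈ K, legGain (x + y) (x * y) (k i) +
      (y * x ^ #K + x * y ^ #K) * ∏ i ∈ K, legSkew (x + y) (x * y) (k i + 1)) ∈
      schurCone (x + y) (x * y) := by
  have h1 := e₁_mem (x + y) (x * y)
  have h2 := e₂_mem (x + y) (x * y)
  have h5 : (2 : R) ∈ elemPos (x + y) (x * y) := two_mem_elemPos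
  have hB : ∏ i ∈ K, legSkew (x + y) (x * y) (k i + 1) ∈ elemPos (x + y) (x * y) :=
    prod_mem fun i _ => legSkew_mem _ _ _
  have hg : ∏ i ∈ K, legGain (x + y) (x * y) (k i) ∈ elemPos (x + y) (x * y) :=
    prod_mem fun i _ => legGain_mem _ _ _
  have hK := prod_legGain_sub_mem (x + y) (x * y) k K
  generalize ∏ i ∈ K, legSkew (x + y) (x * y) (k i + 1) = b at *
  generalize ∏ i ∈ K, legGain (x + y) (x * y) (k i) = c at *
  generalize #K = n at *
  match n with
  -- For at most two legs, y x^n + x y^n is itself a polynomial in e₁, e₂ with nonnegative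
  -- coefficients.
  | 0 =>
    have : y * x ^ 0 + x * y ^ 0 = x + y := by ring
    rw [this]
    apply mem_schurCone_of_mem
    simp (maxDischargeDepth := 20) [add_mem, mul_mem, *]
  | 1 =>
    have : y * x ^ 1 + x * y ^ 1 = 2 * (x * y) := by ring
    rw [this]
    apply mem_schurCone_of_mem
    simp (maxDischargeDepth := 20) [add_mem, mul_mem, *]
  | 2 =>
    have : y * x ^ 2 + x * y ^ 2 = (x + y) * (x * y) := by ring
    rw [this]
    apply mem_schurCone_of_mem
    simp (maxDischargeDepth := 20) [add_mem, mul_mem, *]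
  | n + 3 =>
    have : y * x ^ (n + 3) + x * y ^ (n + 3) = x * y * (x ^ (n + 2) + y ^ (n + 2)) := by ring
    rw [this, pow_add_pow_eq_hsym]
    have key : 2 * (c + x * y * (hsym (x + y) (x * y) (n + 2) - x * y * hsym (x + y) (x * y) n) * b)
        = 2 * (c - (x * y) ^ 2 * hsym (x + y) (x * y) n * b) +
          (2 * (x * y) * b) * hsym (x + y) (x * y) (n + 2) := by ring
    rw [key]
    exact add_mem (hK n rfl) (mul_mem_schurCone (mul_mem (mul_mem h5 h2) hB) (hsym_mem _))

/-- The Fibonacci polynomials; `fibPoly x (k + 1)` is the independence polynomial of the path with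
`k` vertices, evaluated at `x`. -/
def fibPoly (x : R) : ℕ → R
  | 0 => 1
  | 1 => 1
  | k + 2 => fibPoly x (k + 1) + x * fibPoly x k

theorem fibPoly_mul_fibPoly (k : ℕ) :
    fibPoly x (k + 1) * fibPoly y (k + 1) = legDiag (x + y) (x * y) (k + 1) ∧
    fibPoly x (k + 2) * fibPoly y (k + 1) = legDiag (x + y) (x * y) (k + 1) +
      x * y * legSkew (x + y) (x * y) k + x * legSkew (x + y) (x * y) (k + 1) ∧
    fibPoly x (k + 1) * fibPoly y (k + 2) = legDiag (x + y) (x * y) (k + 1) +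
      x * y * legSkew (x + y) (x * y) k + y * legSkew (x + y) (x * y) (k + 1) ∧
    fibPoly x k * fibPoly y k = legDiag (x + y) (x * y) k := by
  induction k with
  | zero => simp [fibPoly]
  | succ k ih =>
    obtain ⟨h1, h2, h3, h4⟩ := ih
    have h5 : fibPoly x (k + 2) * fibPoly y (k + 2) = legDiag (x + y) (x * y) (k + 2) := by
      -- These are the cross terms of Q_{k+2}(x)Q_{k+2}(y), isolated by adding the two mixed
      -- identities.
      have e : fibPoly x (k + 1) * (y * fibPoly y k) + x * fibPoly x k * fibPoly y (k + 1) =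
          (x + y) * legSkew (x + y) (x * y) (k + 1) + 2 * (x * y) * legSkew (x + y) (x * y) k := by
        have h2' : (fibPoly x (k + 1) + x * fibPoly x k) * fibPoly y (k + 1) =
          legDiag (x + y) (x * y) (k + 1) +
          x * y * legSkew (x + y) (x * y) k + x * legSkew (x + y) (x * y) (k + 1) := h2
        have h3' : fibPoly x (k + 1) * (fibPoly y (k + 1) + y * fibPoly y k) =
          legDiag (x + y) (x * y) (k + 1) +
          x * y * legSkew (x + y) (x * y) k + y * legSkew (x + y) (x * y) (k + 1) := h3
        linear_combination h2' + h3' - 2 * h1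
      rw [legDiag_add_two]
      simp only [fibPoly]
      linear_combination h1 + e + x * y * h4
    refine ⟨h5, ?_, ?_, h1⟩
    · rw [legSkew_add_two]
      have : fibPoly x (k + 1 + 2) = fibPoly x (k + 2) + x * fibPoly x (k + 1) := rfl
      rw [this]
      linear_combination h5 + x * h3
    · rw [legSkew_add_two]
      have : fibPoly y (k + 1 + 2) = fibPoly y (k + 2) + y * fibPoly y (k + 1) := rfl
      rw [this]
      linear_combination h5 + y * h2

open Finset in
/-- Two-variable Schur positivity for spiders: leg `i` has `k i` vertices. -/
theorem spider_mem_schurCone {ι : Type*} [DecidableEq ι] (k : ι → ℕ) (hk : ∀ i, 1 ≤ k i)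
    (s : Finset ι) :
    2 * ((∏ i ∈ s, fibPoly x (k i + 1) + x * ∏ i ∈ s, fibPoly x (k i)) *
      (∏ i ∈ s, fibPoly y (k i + 1) + y * ∏ i ∈ s, fibPoly y (k i))) ∈
      schurCone (x + y) (x * y) := by
  obtain ⟨m, rfl⟩ : ∃ m : ι → ℕ, k = fun i => m i + 1 :=
    ⟨fun i => k i - 1, funext fun i => (Nat.sub_add_cancel (hk i)).symm⟩
  -- The symmetric summand shared by Q_{m+2}(x)Q_{m+1}(y), its mirror image, and
  -- Q_{m+2}(x)Q_{m+2}(y).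
  set σ : ι → R := fun i => legDiag (x + y) (x * y) (m i + 1) + x * y * legSkew (x + y) (x * y) (m i)
  have hσ : ∀ i, σ i ∈ elemPos (x + y) (x * y) := fun i =>
    add_mem (legDiag_mem _ _ _) (mul_mem (e₂_mem _ _) (legSkew_mem _ _ _))
  have e : (∏ i ∈ s, fibPoly x (m i + 1 + 1) + x * ∏ i ∈ s, fibPoly x (m i + 1)) *
      (∏ i ∈ s, fibPoly y (m i + 1 + 1) + y * ∏ i ∈ s, fibPoly y (m i + 1)) =
      x * y * ∏ i ∈ s, legDiag (x + y) (x * y) (m i + 1) +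
      (∏ i ∈ s, (legGain (x + y) (x * y) (m i) + σ i) +
      y * ∏ i ∈ s, (x * legSkew (x + y) (x * y) (m i + 1) + σ i) +
      x * ∏ i ∈ s, (y * legSkew (x + y) (x * y) (m i + 1) + σ i)) := by
    have a1 : (∏ i ∈ s, fibPoly x (m i + 1 + 1)) * ∏ i ∈ s, fibPoly y (m i + 1 + 1) =
        ∏ i ∈ s, (legGain (x + y) (x * y) (m i) + σ i) := by
      rw [← prod_mul_distrib]
      refine prod_congr rfl fun i _ => ?_
      rw [(fibPoly_mul_fibPoly x y (m i + 1)).1, legDiag_add_two]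
      simp only [legGain, σ]; ring
    have a2 : (∏ i ∈ s, fibPoly x (m i + 1)) * ∏ i ∈ s, fibPoly y (m i + 1) =
        ∏ i ∈ s, legDiag (x + y) (x * y) (m i + 1) := by
      rw [← prod_mul_distrib]
      exact prod_congr rfl fun i _ => (fibPoly_mul_fibPoly x y (m i)).1
    have a3 : (∏ i ∈ s, fibPoly x (m i + 1 + 1)) * ∏ i ∈ s, fibPoly y (m i + 1) =
        ∏ i ∈ s, (x * legSkew (x + y) (x * y) (m i + 1) + σ i) := by
      rw [← prod_mul_distrib]
      refine prod_congr rfl fun i _ => ?_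
      rw [(fibPoly_mul_fibPoly x y (m i)).2.1]
      simp only [σ]; ring
    have a4 : (∏ i ∈ s, fibPoly x (m i + 1)) * ∏ i ∈ s, fibPoly y (m i + 1 + 1) =
        ∏ i ∈ s, (y * legSkew (x + y) (x * y) (m i + 1) + σ i) := by
      rw [← prod_mul_distrib]
      refine prod_congr rfl fun i _ => ?_
      rw [(fibPoly_mul_fibPoly x y (m i)).2.2.1]
      simp only [σ]; ring
    rw [← a1, ← a2, ← a3, ← a4]
    ring
  -- All three products are expanded over the same K, the legs at which the summand other than σ is
  -- chosen.
  have e' : ∏ i ∈ s, (legGain (x + y) (x * y) (m i) + σ i) +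
      y * ∏ i ∈ s, (x * legSkew (x + y) (x * y) (m i + 1) + σ i) +
      x * ∏ i ∈ s, (y * legSkew (x + y) (x * y) (m i + 1) + σ i) =
      ∑ K ∈ s.powerset, (∏ i ∈ s \ K, σ i) * (∏ i ∈ K, legGain (x + y) (x * y) (m i) +
      (y * x ^ #K + x * y ^ #K) * ∏ i ∈ K, legSkew (x + y) (x * y) (m i + 1)) := by
    rw [prod_add, prod_add, prod_add, mul_sum, mul_sum, ← sum_add_distrib, ← sum_add_distrib]
    refine sum_congr rfl fun K _ => ?_
    rw [prod_mul_distrib, prod_mul_distrib, prod_const, prod_const]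
    ring
  rw [e, e', mul_add, mul_sum]
  refine add_mem (mem_schurCone_of_mem ?_) (sum_mem fun K _ => ?_)
  · exact mul_mem two_mem_elemPos (mul_mem (e₂_mem _ _) (prod_mem fun i _ => legDiag_mem _ _ _))
  · rw [mul_left_comm]
    exact mul_mem_schurCone (prod_mem fun i _ => hσ i) (prod_legGain_add_mem x y m K)

end Spider

/-! ### Coefficients of Schur-positive polynomials -/

section Coeff

open Polynomial

theorem hsym_succ_eq {R : Type*} [CommRing R] (x y : R) (n : ℕ) :
    hsym (x + y) (x * y) (n + 1) = x * hsym (x + y) (x * y) n + y ^ (n + 1) := by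
  induction n with
  | zero => simp [hsym]
  | succ n ih =>
    have : hsym (x + y) (x * y) (n + 1 + 1) =
      (x + y) * hsym (x + y) (x * y) (n + 1) - x * y * hsym (x + y) (x * y) n := rfl
    rw [this]
    linear_combination y * ih

/-- The outer variable plays x and the inner one y; h_n is the sum of all monomials of degree n. -/
theorem coeff_coeff_hsym (n p r : ℕ) :
    ((hsym (Polynomial.X + C Polynomial.X) (Polynomial.X * C Polynomial.X) n : ℚ[X][X]).coeff p).coeff r = if p + r = n then 1 else 0 := by
  induction n generalizing p with
  | zero =>
    rcases p with _ | p <;> simp [hsym, coeff_one]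
  | succ n ih =>
    rw [hsym_succ_eq, ← C_pow]
    rcases p with _ | p
    · rw [coeff_add, coeff_X_mul_zero, zero_add, coeff_C_zero, coeff_X_pow]
      simp
    · rw [coeff_add, coeff_X_mul, coeff_C_succ, add_zero, ih]
      congr 1
      simp only [eq_iff_iff]; lia

theorem coeff_coeff_schur (b n p r : ℕ) :
    (((Polynomial.X * C Polynomial.X : ℚ[X][X]) ^ b *
      hsym (Polynomial.X + C Polynomial.X) (Polynomial.X * C Polynomial.X) n).coeff p).coeff r =
      if p + r = 2 * b + n ∧ b ≤ p ∧ b ≤ r then 1 else 0 := by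
  rw [mul_pow, ← C_pow, mul_assoc, coeff_X_pow_mul']
  split_ifs with h1 h2 h2
  · rw [coeff_C_mul, coeff_X_pow_mul', if_pos h2.2.2, coeff_coeff_hsym, if_pos (by lia)]
  · rw [coeff_C_mul, coeff_X_pow_mul']
    split_ifs with h3
    · rw [coeff_coeff_hsym, if_neg (by lia)]
    · rfl
  · lia
  · simp

/-- In each degree the coefficients of e₂^b h_n are 1 on an interval symmetric about the middle and
0 outside, so a move towards the middle cannot lower them. -/
theorem coeff_le_of_mem_schurCone {f : ℚ[X][X]} (hf : f ∈ schurCone (Polynomial.X + C Polynomial.X) (Polynomial.X * C Polynomial.X))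
    {p r : ℕ} (h : r + 1 ≤ p) : (f.coeff (p + 1)).coeff r ≤ (f.coeff p).coeff (r + 1) := by
  induction hf using AddSubmonoid.closure_induction with
  | mem f hf =>
    obtain ⟨b, n, rfl⟩ := hf
    rw [coeff_coeff_schur, coeff_coeff_schur]
    split_ifs
    · exact le_rfl
    · lia
    · exact zero_le_one
    · exact le_rfl
  | zero => simp
  | add f g _ _ hf hg =>
    simp only [coeff_add]
    exact add_le_add hf hg

theorem coeff_coeff_map_mul_C (F : ℚ[X]) (p r : ℕ) :
    ((F.map C * C F).coeff p).coeff r = F.coeff p * F.coeff r := by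
  rw [coeff_mul_C, coeff_map, coeff_C_mul]

end Coeff

/-! ### Independence polynomials of spiders -/

section Graph

open Finset Polynomial

variable {V : Type*} [Fintype V]

/-- The number of independent sets of cardinality `j`. -/
noncomputable def indepCount (G : SimpleGraph V) (j : ℕ) : ℕ := {s : Finset V | G.IsNIndepSet j s}.ncard

theorem indepCount_eq_zero {G : SimpleGraph V} {j : ℕ} (h : G.indepNum < j) :
    indepCount G j = 0 := by
  rw [indepCount, Set.ncard_eq_zero]
  ext s
  simp only [Set.mem_ofPred_eq, Set.mem_empty_iff_false, iff_false]
  intro hs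
  have := hs.1.card_le_indepNum
  rw [hs.2] at this
  lia

theorem coeff_indepPoly (G : SimpleGraph V) (j : ℕ) :
    (indepPoly G).coeff j = indepCount G j := by
  rw [indepPoly, finsetSum_coeff]
  simp only [coeff_monomial]
  rw [Finset.sum_ite_eq' (range (G.indepNum + 1))]
  split_ifs with h
  · rfl
  · rw [indepCount_eq_zero (by simpa using h), Nat.cast_zero]

/-- The indicator functions of independent sets. -/
def IsIndep (G : SimpleGraph V) (f : V → Bool) : Prop := ∀ u v, G.Adj u v → ¬(f u ∧ f v)

open Classical in
/-- The independence polynomial as a sum over indicator functions. -/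
theorem indepPoly_eq_sum [DecidableEq V] (G : SimpleGraph V) :
    indepPoly G = ∑ f : V → Bool, if IsIndep G f then ∏ v, (if f v then Polynomial.X else 1) else 0 := by
  ext j
  have e : ∀ f : V → Bool, (∏ v, (if f v then Polynomial.X else 1) : ℚ[X]) = Polynomial.X ^ #{v | f v} := by
    intro f
    rw [prod_ite, prod_const, prod_const_one, mul_one]
  simp only [e]
  have e' : {s : Finset V | G.IsNIndepSet j s} =
      ((univ.filter fun s => G.IsNIndepSet j s : Finset (Finset V)) : Set (Finset V)) := by
    ext; simp
  rw [coeff_indepPoly, finsetSum_coeff, indepCount, e', Set.ncard_coe_finset]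
  simp only [apply_ite (fun P : ℚ[X] => P.coeff j), coeff_X_pow, coeff_zero]
  simp only [← ite_and]
  rw [sum_boole]
  congr 1
  refine card_bij' (fun s _ v => decide (v ∈ s)) (fun f _ => ({v | f v} : Finset V)) ?_ ?_ ?_ ?_
  · intro s hs
    rw [mem_filter] at hs ⊢
    refine ⟨mem_univ _, ?_, by simp [hs.2.2]⟩
    simp only [IsIndep, decide_eq_true_eq]
    rintro u v huv ⟨hu, hv⟩
    exact hs.2.1 hu hv huv.ne huv
  · intro f hf
    rw [mem_filter] at hf ⊢
    refine ⟨mem_univ _, ?_, hf.2.2.symm⟩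
    intro u hu v hv _ huv
    exact hf.2.1 u v huv ⟨by simpa using hu, by simpa using hv⟩
  · intro s _
    ext v; simp
  · intro f _
    ext v; simp

/-- The indicator function of an independent set of a path. -/
def PathOK {n : ℕ} (f : Fin n → Bool) : Prop :=
  ∀ i j : Fin n, (j : ℕ) = i + 1 → ¬(f i ∧ f j)

/-- `f` vanishes on the first vertex of the path. -/
def HeadOK {n : ℕ} (f : Fin n → Bool) : Prop := ∀ i : Fin n, (i : ℕ) = 0 → f i = false

theorem pathOK_cons {n : ℕ} (c : Bool) (f : Fin n → Bool) :
    PathOK (Fin.cons c f : Fin (n + 1) → Bool) ↔ PathOK f ∧ (c = true → HeadOK f) := by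
  constructor
  · intro h
    refine ⟨fun i j hij => ?_, fun hc i hi => ?_⟩
    · simpa using h i.succ j.succ (by simpa using hij)
    · simpa [hc] using h 0 i.succ (by simpa using hi)
  · rintro ⟨h1, h2⟩ i j hij
    induction j using Fin.cases with
    | zero => simp at hij
    | succ j =>
      induction i using Fin.cases with
      | zero =>
        rintro ⟨ha, hb⟩
        simp only [Fin.cons_zero, Fin.cons_succ] at ha hb
        rw [h2 ha j (by simpa using hij)] at hb
        exact absurd hb (by simp)
      | succ i => simpa using h1 i j (by simpa using hij)

theorem headOK_cons {n : ℕ} (c : Bool) (f : Fin n → Bool) :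
    HeadOK (Fin.cons c f : Fin (n + 1) → Bool) ↔ c = false := by
  constructor
  · intro h; exact h 0 rfl
  · intro h i hi
    have : i = 0 := Fin.ext hi
    subst this
    simpa using h

open Classical in
-- Condition on the first vertex. The second sum counts a path with one vertex fewer; for n = 0 the
-- convention Q_0 = 1 is what makes it correct.
theorem sum_path {R : Type*} [CommRing R] (x : R) (n : ℕ) :
    (∑ f : Fin n → Bool, if PathOK f then ∏ i, (if f i then x else 1) else 0) =
      fibPoly x (n + 1) ∧
    (∑ f : Fin n → Bool, if PathOK f ∧ HeadOK f then ∏ i, (if f i then x else 1) else 0) =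
      fibPoly x n := by
  induction n with
  | zero => simp [PathOK, HeadOK, fibPoly]
  | succ n ih =>
    have e : ∀ F : (Fin (n + 1) → Bool) → R,
        ∑ f, F f = ∑ f : Fin n → Bool, F (Fin.cons true f) + ∑ f, F (Fin.cons false f) := by
      intro F
      rw [← (Fin.consEquiv fun _ => Bool).sum_comp, Fintype.sum_prod_type, Fintype.sum_bool]
      rfl
    simp only [e, pathOK_cons, headOK_cons, Fin.prod_univ_succ, Fin.cons_zero, Fin.cons_succ]
    constructor
    · have : fibPoly x (n + 1 + 1) = fibPoly x (n + 1) + x * fibPoly x n := rfl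
      rw [this, ← ih.1, ← ih.2, mul_sum, add_comm]
      congr 1
      · simp
      · refine sum_congr rfl fun f _ => ?_
        simp
    · rw [← ih.1]
      simp

theorem spider_adj_iff (L : List ℕ) (u v : SpiderVertex L) :
    (spiderOfList L).Adj u v ↔ spiderArc L u v ∨ spiderArc L v u := by
  rw [spiderOfList, SimpleGraph.fromRel_adj, and_iff_right_of_imp]
  rintro h rfl
  match u with
  | none => simp [spiderArc] at h
  | some u => simp [spiderArc] at h

theorem isIndep_spider_iff (L : List ℕ) (f : SpiderVertex L → Bool) :
    IsIndep (spiderOfList L) f ↔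
      ∀ i, PathOK (fun j => f (some ⟨i, j⟩)) ∧
        (f none = true → HeadOK (fun j => f (some ⟨i, j⟩))) := by
  constructor
  · intro h i
    refine ⟨fun j k hjk => h _ _ ?_, fun h0 j hj => ?_⟩
    · rw [spider_adj_iff]
      exact Or.inl ⟨rfl, hjk⟩
    · have := h none (some ⟨i, j⟩) (by rw [spider_adj_iff]; exact Or.inl hj)
      simpa [h0] using this
  · intro h
    have key : ∀ u v, spiderArc L u v → ¬(f u ∧ f v) := by
      rintro (_ | ⟨i, j⟩) (_ | ⟨i', j'⟩) huv ⟨hu, hv⟩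
      · exact huv
      · have := (h i').2 hu j' huv
        simp_all
      · exact huv
      · obtain ⟨h1, h2⟩ := huv
        dsimp only at h1 h2
        subst h1
        exact (h i).1 j j' h2 ⟨hu, hv⟩
    intro u v huv
    rw [spider_adj_iff] at huv
    rcases huv with huv | huv
    · exact key u v huv
    · rw [and_comm]; exact key v u huv

open Classical in
-- Condition on the torso: if it is chosen, the first vertex of every leg is excluded.
theorem indepPoly_spiderOfList (L : List ℕ) :
    indepPoly (spiderOfList L) = ∏ i : Fin L.length, fibPoly Polynomial.X (L.get i + 1) +
      Polynomial.X * ∏ i : Fin L.length, fibPoly Polynomial.X (L.get i) := by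
  rw [indepPoly_eq_sum]
  have e : ∀ F : (SpiderVertex L → Bool) → ℚ[X], ∑ f, F f =
      ∑ c : Bool, ∑ h : (∀ i : Fin L.length, Fin (L.get i) → Bool),
        F (fun v => v.elim c fun w => h w.1 w.2) := by
    intro F
    rw [← (Equiv.piOptionEquivProd (β := fun _ => Bool)).symm.sum_comp, Fintype.sum_prod_type]
    refine sum_congr rfl fun c _ => ?_
    rw [← (Equiv.piCurry fun (i : Fin L.length) (_ : Fin (L.get i)) => Bool).symm.sum_comp]
    refine sum_congr rfl fun h _ => ?_
    congr 1
    funext v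
    rcases v with _ | v <;> rfl
  rw [e]
  simp only [isIndep_spider_iff, Fintype.prod_option, Option.elim_none, Option.elim_some,
    Fintype.prod_sigma]
  rw [Fintype.sum_bool, add_comm]
  congr 1
  · simp only [← (sum_path (Polynomial.X : ℚ[X]) _).1]
    rw [prod_univ_sum, Fintype.piFinset_univ]
    refine sum_congr rfl fun h _ => ?_
    simp [prod_ite_zero]
    rfl
  · simp only [← (sum_path (Polynomial.X : ℚ[X]) _).2]
    rw [prod_univ_sum, Fintype.piFinset_univ, mul_sum]
    refine sum_congr rfl fun h _ => ?_
    simp [prod_ite_zero]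
    rfl

theorem map_fibPoly {R S : Type*} [CommRing R] [CommRing S] (φ : R →+* S) (x : R) (n : ℕ) :
    φ (fibPoly x n) = fibPoly (φ x) n := by
  induction n using Nat.twoStepInduction with
  | zero => simp [fibPoly]
  | one => simp [fibPoly]
  | more n h1 h2 => simp [fibPoly, h1, h2]

theorem indepCount_spider_mul_le (L : List ℕ) (hL : ∀ m ∈ L, 1 ≤ m) {p r : ℕ} (h : r + 1 ≤ p) :
    indepCount (spiderOfList L) (p + 1) * indepCount (spiderOfList L) r ≤
      indepCount (spiderOfList L) p * indepCount (spiderOfList L) (r + 1) := by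
  set F := indepPoly (spiderOfList L) with hF
  -- `F.map C * C F` is I(x)I(y), whose coefficient at x^p y^r is i_p i_r.
  have hmem : 2 * (F.map C * C F) ∈ schurCone (Polynomial.X + C Polynomial.X : ℚ[X][X]) (Polynomial.X * C Polynomial.X) := by
    have := spider_mem_schurCone (Polynomial.X : ℚ[X][X]) (C Polynomial.X) (fun i : Fin L.length => L.get i)
      (fun i => hL _ (L.get_mem i)) univ
    convert this using 3
    · rw [hF, indepPoly_spiderOfList, ← coe_mapRingHom]
      simp only [map_add, map_mul, map_prod, map_fibPoly, coe_mapRingHom, map_X]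
    · rw [hF, indepPoly_spiderOfList]
      simp only [map_add, map_mul, map_prod, map_fibPoly]
  have := coeff_le_of_mem_schurCone hmem h
  rw [two_mul, coeff_add, coeff_add, coeff_add, coeff_add, coeff_coeff_map_mul_C,
    coeff_coeff_map_mul_C, hF] at this
  simp only [coeff_indepPoly] at this
  have h2 : (indepCount (spiderOfList L) (p + 1) * indepCount (spiderOfList L) r : ℚ) ≤
      indepCount (spiderOfList L) p * indepCount (spiderOfList L) (r + 1) := by linarith
  exact_mod_cast h2

/-- The hypothesis covers all r < p, not only consecutive indices, so the pair moves inwards step by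
step without division, and vanishing coefficients do no harm. -/
theorem stronglyLogConcave_of_le {G : SimpleGraph V}
    (h : ∀ p r, r + 1 ≤ p →
      indepCount G (p + 1) * indepCount G r ≤ indepCount G p * indepCount G (r + 1)) :
    IsStronglyLogConcave (indepPoly G) := by
  have key : ∀ k r p, r + 1 ≤ p →
      r + k + 1 ≤ p → indepCount G (p + k + 1) * indepCount G r ≤
        indepCount G p * indepCount G (r + k + 1) := by
    intro k
    induction k with
    | zero => exact fun r p h1 _ => h p r h1
    | succ k ih =>
      intro r p h1 h2
      refine (h (p + k + 1) r (by lia)).trans ?_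
      have := ih (r + 1) p (by lia) (by lia)
      rwa [show r + (k + 1) + 1 = r + 1 + k + 1 by ring]
  intro p m n r hpm hmn hnr _ hsum
  simp only [coeff_indepPoly]
  have := key (m - p - 1) p n (by lia) (by lia)
  rw [show n + (m - p - 1) + 1 = r by lia, show p + (m - p - 1) + 1 = m by lia] at this
  rw [mul_comm, mul_comm (indepCount G m : ℚ)]
  exact_mod_cast this

end Graph

/-! ### The coefficients of `Y_G` -/

section Multicolorings

open Finset

variable {V : Type*} [Fintype V]

/-- The proper multicolorings of any type in which colour `i` is used at `a i` vertices. -/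
def allMulticolorings (G : SimpleGraph V) (a : ℕ →₀ ℕ) : Set (V → Finset ℕ) :=
  {κ | (∀ u v, G.Adj u v → Disjoint (κ u) (κ v)) ∧ ∀ i, #{v | i ∈ κ v} = a i}

theorem mem_multicolorings_iff {G : SimpleGraph V} {α : V → ℕ} {a : ℕ →₀ ℕ} {κ : V → Finset ℕ} :
    κ ∈ multicolorings G α a ↔ κ ∈ allMulticolorings G a ∧ (fun v => #(κ v)) = α := by
  simp only [multicolorings, allMulticolorings, Set.mem_ofPred_eq, funext_iff]
  tauto

theorem subset_support_of_mem {G : SimpleGraph V} {a : ℕ →₀ ℕ}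
    {κ : V → Finset ℕ} (h : κ ∈ allMulticolorings G a) (v : V) : κ v ⊆ a.support :=
  multicolorings_subset_support (mem_multicolorings_iff.2 ⟨h, rfl⟩) v

theorem allMulticolorings_finite (G : SimpleGraph V) (a : ℕ →₀ ℕ) :
    (allMulticolorings G a).Finite := by
  classical
  refine (Finset.finite_toSet (Fintype.piFinset fun _ : V => a.support.powerset)).subset ?_
  intro κ h
  simpa using subset_support_of_mem h

open Classical in
theorem coeff_Y_eq_ncard (G : SimpleGraph V) (a : ℕ →₀ ℕ) :
    MvPowerSeries.coeff a (Y G) = ((allMulticolorings G a).ncard : ℚ) := by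
  set U := (allMulticolorings_finite G a).toFinset with hU
  have h1 : ∀ α : V → ℕ, (multicolorings G α a).ncard = #{κ ∈ U | (fun v => #(κ v)) = α} := by
    intro α
    rw [← Set.ncard_coe_finset]
    congr 1
    ext κ
    simp [hU, mem_multicolorings_iff]
  have h2 : MvPowerSeries.coeff a (Y G) =
      ∑ᶠ α : V → ℕ, ((#{κ ∈ U | (fun v => #(κ v)) = α} : ℕ) : ℚ) := by
    simp only [← h1]
    rfl
  rw [h2, finsum_eq_sum_of_support_subset (s := U.image fun κ v => #(κ v))]
  · rw [Set.ncard_eq_toFinset_card _ (allMulticolorings_finite G a), ← Nat.cast_sum]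
    congr 1
    exact (card_eq_sum_card_image _ _).symm
  · intro α hα
    rw [Function.mem_support, Nat.cast_ne_zero, card_ne_zero] at hα
    obtain ⟨κ, hκ⟩ := hα
    rw [mem_filter] at hκ
    rw [mem_coe, mem_image]
    exact ⟨κ, hκ⟩

open Classical in
-- Properness constrains each colour separately, so a multicoloring is an independent choice of one
-- independent set per colour.
theorem ncard_allMulticolorings (G : SimpleGraph V) (a : ℕ →₀ ℕ) :
    (allMulticolorings G a).ncard = a.prod fun _ k => indepCount G k := by
  have e : ∀ j, indepCount G j = #{s : Finset V | G.IsNIndepSet j s} := by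
    intro j
    rw [indepCount, ← Set.ncard_coe_finset]
    congr 1
    ext; simp
  rw [Set.ncard_eq_toFinset_card _ (allMulticolorings_finite G a), Finsupp.prod]
  simp only [e]
  rw [← card_pi]
  refine card_bij' (fun κ _ i _ => ({v | i ∈ κ v} : Finset V))
    (fun F _ v => a.support.filter fun i => ∃ h : i ∈ a.support, v ∈ F i h) ?_ ?_ ?_ ?_
  · intro κ hκ
    rw [Set.Finite.mem_toFinset] at hκ
    rw [mem_pi]
    intro i _
    rw [mem_filter]
    refine ⟨mem_univ _, ?_, hκ.2 i⟩
    intro u hu v hv _ huv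
    simp only [coe_filter, mem_univ, true_and, Set.mem_ofPred_eq] at hu hv
    exact disjoint_left.1 (hκ.1 u v huv) hu hv
  · intro F hF
    rw [mem_pi] at hF
    rw [Set.Finite.mem_toFinset]
    refine ⟨fun u v huv => ?_, fun i => ?_⟩
    · rw [disjoint_left]
      intro i hu hv
      rw [mem_filter] at hu hv
      obtain ⟨hi, hu⟩ := hu.2
      obtain ⟨_, hv⟩ := hv.2
      have := hF i hi
      rw [mem_filter] at this
      exact this.2.1 hu hv huv.ne huv
    · by_cases hi : i ∈ a.support
      · have := hF i hi
        rw [mem_filter] at this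
        rw [← this.2.2]
        congr 1
        ext v
        simp only [mem_filter, mem_univ, true_and]
        exact ⟨fun h => h.2.2, fun h => ⟨hi, hi, h⟩⟩
      · rw [Finsupp.notMem_support_iff.1 hi, card_eq_zero]
        ext v
        simp only [mem_filter, mem_univ, true_and, notMem_empty, iff_false]
        exact fun h => hi h.1
  · intro κ hκ
    rw [Set.Finite.mem_toFinset] at hκ
    funext v
    ext i
    simp only [mem_filter, mem_univ, true_and]
    exact ⟨fun h => h.2.2, fun h =>
      ⟨subset_support_of_mem hκ v h, subset_support_of_mem hκ v h, h⟩⟩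
  · intro F _
    funext i hi
    ext v
    simp only [mem_filter, mem_univ, true_and]
    exact ⟨fun h => h.2.2, fun h => ⟨hi, hi, h⟩⟩

theorem coeff_Y (G : SimpleGraph V) (a : ℕ →₀ ℕ) :
    MvPowerSeries.coeff a (Y G) = a.prod fun _ k => (indepCount G k : ℚ) := by
  rw [coeff_Y_eq_ncard, ncard_allMulticolorings, Finsupp.prod, Finsupp.prod, Nat.cast_prod]

end Multicolorings

theorem indepCount_zero {V : Type*} (G : SimpleGraph V) : indepCount G 0 = 1 := by
  rw [indepCount, Set.ncard_eq_one]
  refine ⟨∅, ?_⟩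
  ext s
  simp only [Set.mem_ofPred_eq, Set.mem_singleton_iff]
  constructor
  · exact fun h => Finset.card_eq_zero.1 h.2
  · rintro rfl
    exact ⟨by simp, rfl⟩

/-! ### Elementary symmetric functions -/

section ElemSymm

open Finset

theorem sum_single_one_apply {σ : Type*} [DecidableEq σ] (t : Finset σ) (j : σ) :
    (∑ i ∈ t, Finsupp.single i 1 : σ →₀ ℕ) j = if j ∈ t then 1 else 0 := by
  rw [Finsupp.finsetSum_apply]
  simp [Finsupp.single_apply]

theorem degree_sum_single_one {σ : Type*} (t : Finset σ) :
    (∑ i ∈ t, Finsupp.single i 1 : σ →₀ ℕ).degree = #t := by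
  rw [map_sum]
  simp

open Classical in
theorem coeff_esymm {σ : Type*} [Fintype σ] (k : ℕ) (d : σ →₀ ℕ) :
    (MvPolynomial.esymm σ ℚ k).coeff d = if (∀ i, d i ≤ 1) ∧ d.degree = k then 1 else 0 := by
  rw [MvPolynomial.esymm_eq_sum_monomial, MvPolynomial.coeff_sum]
  simp only [MvPolynomial.coeff_monomial]
  split_ifs with h
  · have hd : (∑ i ∈ d.support, Finsupp.single i 1 : σ →₀ ℕ) = d := by
      ext j
      rw [sum_single_one_apply]
      have := h.1 j
      split_ifs with hj
      · rw [Finsupp.mem_support_iff] at hj; lia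
      · rw [Finsupp.notMem_support_iff] at hj; lia
    rw [sum_eq_single d.support, if_pos hd]
    · intro t _ ht
      rw [if_neg]
      intro h2
      refine ht ?_
      ext j
      rw [← h2, Finsupp.mem_support_iff, sum_single_one_apply]
      simp
    · intro h3
      refine absurd ?_ h3
      rw [mem_powersetCard_univ, ← h.2, ← hd, degree_sum_single_one, hd]
  · refine sum_eq_zero fun t ht => if_neg ?_
    rintro rfl
    refine h ⟨fun i => ?_, ?_⟩
    · rw [sum_single_one_apply]; split_ifs <;> simp
    · rw [degree_sum_single_one]; exact mem_powersetCard_univ.1 ht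

theorem degree_embDomain {σ τ : Type*} (e : σ ↪ τ) (d : σ →₀ ℕ) :
    (d.embDomain e).degree = d.degree := by
  rw [Finsupp.embDomain_eq_mapDomain, Finsupp.degree_mapDomain]

theorem killCompl_elemSymm {σ : Type*} [Fintype σ] (e : σ ↪ ℕ) (k : ℕ) :
    MvPowerSeries.killCompl e (elemSymm k : MvPowerSeries ℕ ℚ) =
      (MvPolynomial.esymm σ ℚ k : MvPowerSeries σ ℚ) := by
  classical
  ext d
  rw [MvPowerSeries.coeff_killCompl, MvPolynomial.coeff_coe, coeff_esymm]
  change (if (∀ i, d.embDomain e i ≤ 1) ∧ ((d.embDomain e).degree : ℤ) = k then (1 : ℚ) else 0) = _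
  simp only [degree_embDomain, Nat.cast_inj]
  congr 1
  rw [eq_iff_iff, and_congr_left_iff]
  refine fun _ => ⟨fun h i => ?_, fun h j => ?_⟩
  · simpa using h (e i)
  · by_cases hj : j ∈ Set.range e
    · obtain ⟨i, rfl⟩ := hj
      simpa using h i
    · rw [Finsupp.embDomain_of_notMem_range _ _ _ hj]; exact zero_le_one

theorem isHomogeneous_elemSymm (k : ℕ) : (elemSymm k : MvPowerSeries ℕ ℚ).IsHomogeneous k := by
  intro d hd
  change Finsupp.weight (fun _ => 1) d = k
  rw [← Finsupp.degree_eq_weight_one]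
  by_contra h
  exact hd (if_neg fun h' => h (by exact_mod_cast h'.2))

theorem elemSymm_zero : elemSymm 0 = 1 := by
  classical
  ext d
  rw [MvPowerSeries.coeff_one]
  change (if (∀ i, d i ≤ 1) ∧ (d.degree : ℤ) = 0 then (1 : ℚ) else 0) = _
  congr 1
  rw [eq_iff_iff, Nat.cast_eq_zero, Finsupp.degree_eq_zero_iff]
  constructor
  · exact fun h => h.2
  · rintro rfl; simp

theorem elemSymm_of_neg {k : ℤ} (hk : k < 0) : elemSymm k = 0 := by
  ext d
  exact if_neg fun h => by lia

end ElemSymm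

/-! ### Symmetric power series are polynomials in elementary symmetric functions -/

section Generation

open Finset

/-- The exponents of degree `n` are supported on at most `n` variables. -/
theorem exists_embDomain_eq {n : ℕ} {a : ℕ →₀ ℕ} (ha : a.degree = n) :
    ∃ (e : Fin n ↪ ℕ) (d : Fin n →₀ ℕ), d.embDomain e = a := by
  have hc : #a.support ≤ n := by
    rw [← ha, Finsupp.degree_apply, card_eq_sum_ones]
    exact sum_le_sum fun i hi => Nat.one_le_iff_ne_zero.2 (Finsupp.mem_support_iff.1 hi)
  obtain ⟨s, hs, hs'⟩ := Infinite.exists_superset_card_eq a.support n hc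
  refine ⟨(s.orderEmbOfFin hs').toEmbedding, _, Finsupp.embDomain_comapDomain ?_⟩
  have := s.range_orderEmbOfFin hs'
  simp only [RelEmbedding.coe_toEmbedding]
  rw [this]
  exact_mod_cast hs

open Classical in
/-- A power series whose coefficients are given by a multiplicative function of the exponents
agrees in degree `n` with a polynomial in elementary symmetric functions. -/
theorem exists_aeval_elemSymm (w : ℕ → ℚ) {f : MvPowerSeries ℕ ℚ}
    (hf : ∀ a, MvPowerSeries.coeff a f = a.prod fun _ k => w k) (n : ℕ) :
    ∃ P : MvPolynomial (Fin n) ℚ, MvPowerSeries.homogeneousComponent n f =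
      MvPowerSeries.homogeneousComponent n
        (MvPolynomial.aeval (fun i : Fin n => elemSymm ((i : ℕ) + 1 : ℕ)) P) := by
  set S : Finset (Fin n →₀ ℕ) := finsuppAntidiag univ n with hS
  set p : MvPolynomial (Fin n) ℚ :=
    ∑ d ∈ S, MvPolynomial.monomial d (d.prod fun _ k => w k) with hp
  have hpc : ∀ d : Fin n →₀ ℕ, p.coeff d = if d.degree = n then d.prod fun _ k => w k else 0 := by
    intro d
    rw [hp, MvPolynomial.coeff_sum]
    simp only [MvPolynomial.coeff_monomial]
    rw [Finset.sum_ite_eq']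
    congr 1
    rw [hS, mem_finsuppAntidiag, Finsupp.degree_eq_sum]
    simp
  have hsymm : p.IsSymmetric := by
    intro σ
    ext d
    obtain ⟨d, rfl⟩ : ∃ d' : Fin n →₀ ℕ, d'.embDomain σ.toEmbedding = d :=
      ⟨_, Finsupp.embDomain_comapDomain (by simp)⟩
    have h : MvPolynomial.rename σ p = MvPolynomial.rename σ.toEmbedding p := rfl
    rw [h, MvPolynomial.coeff_rename_embDomain, hpc, hpc, degree_embDomain, Finsupp.prod_embDomain]
  obtain ⟨P, hP⟩ := MvPolynomial.esymmAlgHom_surjective ℚ (σ := Fin n) (n := n) (by simp) ⟨p, hsymm⟩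
  have hP' : MvPolynomial.aeval (fun i : Fin n => MvPolynomial.esymm (Fin n) ℚ (i + 1)) P = p := by
    rw [← MvPolynomial.esymmAlgHom_apply, hP]
  refine ⟨P, ?_⟩
  ext a
  rw [MvPowerSeries.coeff_homogeneousComponent, MvPowerSeries.coeff_homogeneousComponent]
  split_ifs with ha
  swap; · rfl
  obtain ⟨e, d, rfl⟩ := exists_embDomain_eq ha
  rw [degree_embDomain] at ha
  rw [hf, Finsupp.prod_embDomain, ← MvPowerSeries.coeff_killCompl]
  -- Killing the variables outside the range of `e` turns e_k into the elementary symmetric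
  -- polynomial in n variables, hence P into p.
  have h3 : MvPowerSeries.killCompl e
      (MvPolynomial.aeval (fun i : Fin n => elemSymm ((i : ℕ) + 1 : ℕ)) P) = (p : MvPowerSeries (Fin n) ℚ) := by
    have h4 : ∀ q : MvPolynomial (Fin n) ℚ,
        (q : MvPowerSeries (Fin n) ℚ) = MvPolynomial.coeToMvPowerSeries.algHom ℚ q := by
      intro q
      simp
    rw [← hP', h4, MvPolynomial.comp_aeval_apply, MvPolynomial.comp_aeval_apply]
    simp only [killCompl_elemSymm, ← h4]
  rw [h3, MvPolynomial.coeff_coe, hpc, if_pos ha]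

end Generation

/-! ### Products of elementary symmetric functions are combinations of Schur functions -/

section Span

open Finset

theorem lt_card_filter_iff {m : ℕ} {L : Fin m → ℕ} (hL : Antitone L) (i : Fin m) (j : ℕ) :
    (i : ℕ) + 1 ≤ #{k | j < L k} ↔ j < L i := by
  constructor
  · intro h
    by_contra! hi
    have : ({k | j < L k} : Finset (Fin m)) ⊆ Iio i := by
      intro k hk
      rw [mem_filter] at hk
      rw [mem_Iio]
      by_contra! h2
      have := hL h2
      lia
    have := card_le_card this
    rw [Fin.card_Iio] at this
    lia
  · intro h
    rw [← Fin.card_Iic]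
    refine card_le_card fun k hk => ?_
    rw [mem_filter]
    exact ⟨mem_univ _, h.trans_le (hL (mem_Iic.1 hk))⟩

/-- The partition whose conjugate has the parts `L`. -/
theorem exists_conj {n m : ℕ} {L : Fin m → ℕ} (hL : Antitone L) (hpos : ∀ i, 0 < L i)
    (hsum : ∑ i, L i = n) :
    ∃ lam : n.Partition, lam.parts.sup = m ∧ ∀ i : Fin m, conjPart lam (i + 1) = L i := by
  have hle : ∀ i, L i ≤ n := fun i => hsum ▸ single_le_sum (fun _ _ => Nat.zero_le _) (mem_univ i)
  -- The parts of the conjugate, indexed from 0; `ofSums` discards the zeros.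
  set c : ℕ → ℕ := fun j => #{k | j < L k} with hc
  have hcount : ∀ i, #{j ∈ range n | j < L i} = L i := by
    intro i
    rw [← card_range (L i)]
    congr 1
    ext j
    have := hle i
    simp
    lia
  have hcm : ∀ j, c j ≤ m := fun j => (card_le_univ _).trans (Fintype.card_fin m).le
  set lam : n.Partition := Nat.Partition.ofSums n ((Multiset.range n).map c) (by
    change ∑ j ∈ range n, c j = n
    simp only [hc, card_filter]
    rw [sum_comm]
    simp only [← card_filter, hcount, hsum]) with hlam
  have hparts : lam.parts = ((Multiset.range n).map c).filter (· ≠ 0) := rfl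
  refine ⟨lam, le_antisymm ?_ ?_, fun i => ?_⟩
  · rw [Multiset.sup_le]
    intro b hb
    rw [hparts, Multiset.mem_filter, Multiset.mem_map] at hb
    obtain ⟨⟨j, _, rfl⟩, _⟩ := hb
    exact hcm j
  · rcases Nat.eq_zero_or_pos m with rfl | hm
    · exact Nat.zero_le _
    · have hc0 : c 0 = m := by
        simp [hc, hpos]
      refine Multiset.le_sup ?_
      rw [hparts, Multiset.mem_filter, Multiset.mem_map]
      refine ⟨⟨0, ?_, hc0⟩, hm.ne'⟩
      rw [Multiset.mem_range]
      exact (hpos ⟨0, hm⟩).trans_le (hle _)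
  · rw [conjPart, hparts, Multiset.filter_filter, Multiset.filter_map, Multiset.card_map]
    rw [← hcount i]
    change _ = Multiset.card (Multiset.filter _ (Multiset.range n))
    congr 1
    refine Multiset.filter_congr fun j _ => ?_
    rw [← lt_card_filter_iff hL i j]
    simp only [Function.comp_apply, hc]
    lia

/-- Rearrangement inequality: only the cross terms depend on σ, and pairing a strictly decreasing
with an increasing sequence is the unique minimum. Applied to μ_i = L_i - i, it compares the terms
of the dual Jacobi–Trudi determinant. -/
theorem sum_sq_lt_sum_perm {m : ℕ} {μ : Fin m → ℤ} (hμ : StrictAnti μ) {σ : Equiv.Perm (Fin m)}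
    (hσ : σ ≠ 1) : ∑ i, (μ i + i) ^ 2 < ∑ i, (μ (σ i) + i) ^ 2 := by
  have hanti : Antivary μ fun i : Fin m => ((i : ℕ) : ℤ) := by
    intro i j hij
    have : ((i : ℕ) : ℤ) < ((j : ℕ) : ℤ) := hij
    exact (hμ (by exact_mod_cast this)).le
  have h1 : ∑ i, μ i * ((i : ℕ) : ℤ) < ∑ i, μ (σ i) * ((i : ℕ) : ℤ) := by
    rw [hanti.sum_mul_lt_sum_comp_perm_mul_iff]
    intro h
    refine hσ ?_
    have hmono : StrictMono σ := by
      intro i j hij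
      have := h (show ((i : ℕ) : ℤ) < ((j : ℕ) : ℤ) by exact_mod_cast hij)
      exact lt_of_le_of_ne (hμ.le_iff_ge.1 this) fun h => hij.ne (σ.injective h)
    exact Equiv.ext fun i => congrFun (StrictMono.range_inj hmono strictMono_id |>.1 (by simp)) i
  have h2 : ∑ i, μ (σ i) ^ 2 = ∑ i, μ i ^ 2 := Equiv.sum_comp σ fun i => μ i ^ 2
  simp only [add_sq, sum_add_distrib, h2]
  simp only [mul_assoc, ← mul_sum]
  lia

theorem sum_sq_le_sq_sum (s : Multiset ℕ) : (s.map (· ^ 2)).sum ≤ s.sum ^ 2 := by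
  induction s using Multiset.induction_on with
  | empty => simp
  | cons a s ih =>
    simp only [Multiset.map_cons, Multiset.sum_cons]
    exact (Nat.add_le_add_left ih _).trans (by nlinarith [Nat.zero_le (a * s.sum)])

theorem schur_eq_det {n m : ℕ} {L : Fin m → ℕ} {lam : n.Partition} (h : lam.parts.sup = m)
    (hL : ∀ i : Fin m, conjPart lam (i + 1) = L i) :
    schur lam = (Matrix.of fun i j : Fin m => elemSymm ((L i : ℤ) - (i : ℤ) + (j : ℤ))).det := by
  subst h
  simp only [← hL]
  rfl

/-- Triangularity: the diagonal term of the dual Jacobi–Trudi determinant is the given product, and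
every other nonzero term is a product of e's whose indices have a larger sum of squares. -/
theorem prod_elemSymm_mem_span (n : ℕ) (s : Multiset ℕ) (hs : s.sum = n) :
    (s.map fun k : ℕ => elemSymm k).prod ∈
      Submodule.span ℚ (Set.range (schur : n.Partition → MvPowerSeries ℕ ℚ)) := by
  induction hN : n ^ 2 - (s.map (· ^ 2)).sum using Nat.strong_induction_on generalizing s with
  | _ N ih =>
  subst hN
  set l := (s.filter (· ≠ 0)).sort (· ≥ ·) with hl
  have hls : (l : Multiset ℕ) = s.filter (· ≠ 0) := Multiset.sort_eq _ _
  set L : Fin l.length → ℕ := l.get with hLdef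
  have hanti : Antitone L := (Multiset.pairwise_sort _ _).sortedGE.antitone_get
  have hpos : ∀ i, 0 < L i := by
    intro i
    have : L i ∈ (l : Multiset ℕ) := l.get_mem i
    rw [hls, Multiset.mem_filter] at this
    exact Nat.pos_of_ne_zero this.2
  obtain ⟨k₀, hk₀⟩ : ∃ k₀, s = univ.val.map L + Multiset.replicate k₀ 0 := by
    refine ⟨s.count 0, ?_⟩
    rw [Fin.univ_val_map, hLdef, List.ofFn_get, hls, ← Multiset.filter_eq', add_comm,
      Multiset.filter_add_not]
  have hsum : ∑ i, L i = n := by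
    rw [← hs, hk₀]
    simp [List.sum_ofFn]
  have hsq : (s.map (· ^ 2)).sum = ∑ i, L i ^ 2 := by
    rw [hk₀]
    simp [List.sum_ofFn]
  have hprod : (s.map fun k : ℕ => elemSymm k).prod = ∏ i, elemSymm (L i) := by
    rw [hk₀]
    simp [List.prod_ofFn, elemSymm_zero]
  rw [hprod]
  obtain ⟨lam, hlam, hconj⟩ := exists_conj hanti hpos hsum
  have hdet := schur_eq_det hlam hconj
  rw [Matrix.det_apply, ← Finset.add_sum_erase _ _ (mem_univ (1 : Equiv.Perm (Fin l.length)))] at hdet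
  simp only [Equiv.Perm.sign_one, one_smul, Matrix.of_apply, Equiv.Perm.one_apply,
    sub_add_cancel] at hdet
  rw [← sub_eq_iff_eq_add] at hdet
  rw [← hdet]
  refine Submodule.sub_mem _ (Submodule.subset_span ⟨lam, rfl⟩) (Submodule.sum_mem _ fun σ hσ => ?_)
  rw [Units.smul_def, ← Int.cast_smul_eq_zsmul ℚ]
  refine Submodule.smul_mem _ _ ?_
  by_cases hneg : ∃ i, (L (σ i) : ℤ) - ((σ i : ℕ) : ℤ) + ((i : ℕ) : ℤ) < 0
  · obtain ⟨i, hi⟩ := hneg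
    rw [prod_eq_zero (mem_univ i) (elemSymm_of_neg hi)]
    exact Submodule.zero_mem _
  · push Not at hneg
    set μ : Fin l.length → ℤ := fun i => (L i : ℤ) - ((i : ℕ) : ℤ) with hμ
    have hμanti : StrictAnti μ := by
      intro i j hij
      have h1 := hanti hij.le
      have h2 : (i : ℕ) < j := hij
      simp only [hμ]
      lia
    have hlt := sum_sq_lt_sum_perm hμanti (ne_of_mem_erase hσ)
    choose k hk using fun i => Int.eq_ofNat_of_zero_le (hneg i)
    have hsum' : ∑ i, k i = n := by
      zify
      simp only [← hk, sum_add_distrib, sum_sub_distrib]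
      rw [Equiv.sum_comp σ fun i => (L i : ℤ), Equiv.sum_comp σ fun i => ((i : ℕ) : ℤ),
        sub_add_cancel]
      exact_mod_cast hsum
    have hlt' : ∑ i, L i ^ 2 < ∑ i, k i ^ 2 := by
      zify
      simp only [← hk]
      simpa [hμ] using hlt
    simp only [hk]
    have hs' : (Multiset.map k univ.val).sum = n := hsum'
    have hsq' : ((Multiset.map k univ.val).map (· ^ 2)).sum = ∑ i, k i ^ 2 := by
      rw [Multiset.map_map]; rfl
    have := ih _ ?_ (Multiset.map k univ.val) hs' rfl
    · rw [Multiset.map_map] at this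
      exact this
    -- The bound by n² makes the truncated difference strictly decrease.
    · have h3 := sum_sq_le_sq_sum (Multiset.map k univ.val)
      rw [hs', hsq'] at h3
      rw [hsq, hsq']
      lia

theorem isHomogeneous_prod_elemSymm (s : Multiset ℕ) :
    ((s.map fun k : ℕ => elemSymm k).prod).IsHomogeneous s.sum := by
  induction s using Multiset.induction_on with
  | empty =>
    rw [Multiset.map_zero, Multiset.prod_zero, Multiset.sum_zero, ← elemSymm_zero]
    exact isHomogeneous_elemSymm 0
  | cons a s ih =>
    rw [Multiset.map_cons, Multiset.prod_cons, Multiset.sum_cons]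
    exact MvPowerSeries.IsHomogeneous.mul (isHomogeneous_elemSymm a) ih

theorem homogeneousComponent_aeval_mem_span (n : ℕ) (P : MvPolynomial (Fin n) ℚ) :
    MvPowerSeries.homogeneousComponent n
      (MvPolynomial.aeval (fun i : Fin n => elemSymm ((i : ℕ) + 1 : ℕ)) P) ∈
      Submodule.span ℚ (Set.range (schur : n.Partition → MvPowerSeries ℕ ℚ)) := by
  induction P using MvPolynomial.induction_on' with
  | add p q hp hq =>
    rw [map_add, map_add]
    exact Submodule.add_mem _ hp hq
  | monomial d a =>
    rw [MvPolynomial.aeval_monomial, ← Algebra.smul_def, map_smul]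
    refine Submodule.smul_mem _ _ ?_
    set s := (Finsupp.toMultiset d).map fun i : Fin n => (i : ℕ) + 1 with hs
    have h : (d.prod fun i k => elemSymm ((i : ℕ) + 1 : ℕ) ^ k) =
        (s.map fun k : ℕ => elemSymm k).prod := by
      rw [hs, Multiset.map_map, Finsupp.toMultiset_map, Finsupp.prod_toMultiset,
        Finsupp.prod_mapDomain_index (fun _ => pow_zero _) (fun _ _ _ => pow_add _ _ _)]
      rfl
    rw [h]
    have hhom : ((s.map fun k : ℕ => elemSymm k).prod).IsHomogeneous s.sum :=
      isHomogeneous_prod_elemSymm s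
    by_cases hn : s.sum = n
    · have := MvPowerSeries.isWeightedHomogeneous_iff_eq_weightedHomogeneousComponent.1 hhom
      rw [hn] at this
      rw [MvPowerSeries.homogeneousComponent, ← this]
      exact prod_elemSymm_mem_span n s hn
    · convert Submodule.zero_mem _
      ext a
      rw [MvPowerSeries.coeff_homogeneousComponent, map_zero, ite_eq_right_iff]
      rintro rfl
      exact hhom.coeff_eq_zero (Ne.symm hn)

/-- Every power series whose coefficients are given by a multiplicative function of the exponents
has an expansion in Schur functions. -/
theorem exists_isSchurExpansion (w : ℕ → ℚ) {f : MvPowerSeries ℕ ℚ}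
    (hf : ∀ a, MvPowerSeries.coeff a f = a.prod fun _ k => w k) :
    ∃ c, IsSchurExpansion f c := by
  have : ∀ n : ℕ, ∃ c : n.Partition → ℚ,
      ∑ lam, c lam • schur lam = MvPowerSeries.homogeneousComponent n f := by
    intro n
    obtain ⟨P, hP⟩ := exists_aeval_elemSymm w hf n
    rw [hP]
    exact (Submodule.mem_span_range_iff_exists_fun ℚ).1 (homogeneousComponent_aeval_mem_span n P)
  choose c hc using this
  exact ⟨c, fun n => (hc n).symm⟩

end Span

/-! ### Schur functions in two variables -/

section TwoVariables

open Finset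

/-- The elementary symmetric functions `1, e₁, e₂` of two variables. -/
def elemTwo {R : Type*} [CommRing R] (e₁ e₂ : R) (k : ℤ) : R :=
  if k = 0 then 1 else if k = 1 then e₁ else if k = 2 then e₂ else 0

theorem elemTwo_eq_zero {R : Type*} [CommRing R] (e₁ e₂ : R) {k : ℤ} (hk : k < 0 ∨ 2 < k) :
    elemTwo e₁ e₂ k = 0 := by
  rw [elemTwo, if_neg (by lia), if_neg (by lia), if_neg (by lia)]

/-- The matrix is tridiagonal, with e₁ on the diagonal, e₂ above and 1 below, so its determinant
satisfies the recursion of `hsym`. -/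
theorem det_elemTwo_one {R : Type*} [CommRing R] (e₁ e₂ : R) (m : ℕ) :
    (Matrix.of fun i j : Fin m => elemTwo e₁ e₂ (1 - (i : ℤ) + (j : ℤ))).det = hsym e₁ e₂ m := by
  induction m using Nat.twoStepInduction with
  | zero => simp [hsym]
  | one => simp [hsym, elemTwo]
  | more m h1 h2 =>
    have hrec : hsym e₁ e₂ (m + 2) = e₁ * hsym e₁ e₂ (m + 1) - e₂ * hsym e₁ e₂ m := rfl
    set T : (m : ℕ) → Matrix (Fin m) (Fin m) R :=
      fun m => Matrix.of fun i j => elemTwo e₁ e₂ (1 - (i : ℤ) + (j : ℤ)) with hT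
    have hsub : ∀ m, (T (m + 1)).submatrix Fin.succ Fin.succ = T m := by
      intro m
      ext i j
      simp only [hT, Matrix.submatrix_apply, Matrix.of_apply, Fin.val_succ]
      congr 1
      push_cast
      ring
    have hzero : ∀ (m : ℕ) (i j : Fin m), (j : ℕ) + 1 < i ∨ (i : ℕ) + 1 < j → T m i j = 0 := by
      intro m i j h
      simp only [hT, Matrix.of_apply]
      rw [elemTwo_eq_zero]
      lia
    change (T (m + 2)).det = _
    have hminor : ((T (m + 2)).submatrix Fin.succ (Fin.succAbove 1)).det = (T m).det := by
      rw [Matrix.det_succ_column_zero, Fin.sum_univ_succ, sum_eq_zero, add_zero]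
      · rw [Matrix.submatrix_submatrix, Matrix.submatrix_apply]
        have h3 : (Fin.succAbove 1 ∘ Fin.succ : Fin m → Fin (m + 2)) = Fin.succ ∘ Fin.succ := by
          ext j
          simp [Fin.succAbove, Fin.lt_def]
        have h4 : (Fin.succ ∘ Fin.succAbove 0 : Fin m → Fin (m + 2)) = Fin.succ ∘ Fin.succ := by
          ext j
          simp
        rw [h3, h4, ← Matrix.submatrix_submatrix, hsub, hsub]
        simp [hT, elemTwo]
      · intro i _
        rw [Matrix.submatrix_apply, Fin.succAbove_ne_zero_zero (by simp), hzero _ _ _ (by simp)]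
        ring
    rw [hrec, ← h1, ← h2, Matrix.det_succ_row_zero, Fin.sum_univ_succ, Fin.sum_univ_succ,
      sum_eq_zero, add_zero, sub_eq_add_neg]
    · congr 1
      · rw [Fin.succAbove_zero, hsub]
        simp [hT, elemTwo]
      · rw [Fin.succ_zero_eq_one, hminor]
        simp [hT, elemTwo]
    · intro i _
      rw [hzero _ _ _ (by simp)]
      ring

/-- While b > 0 the first row is (e₂, 0, …, 0), since its later indices exceed 2; each column of
length 2 therefore splits off a factor e₂. -/
theorem det_elemTwo {R : Type*} [CommRing R] (e₁ e₂ : R) (b k m : ℕ) (hm : m = b + k) :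
    (Matrix.of fun i j : Fin m =>
      elemTwo e₁ e₂ (((if (i : ℕ) < b then 2 else 1 : ℕ) : ℤ) - (i : ℤ) + (j : ℤ))).det =
      e₂ ^ b * hsym e₁ e₂ k := by
  induction b generalizing m with
  | zero =>
    rw [zero_add] at hm
    subst hm
    rw [← det_elemTwo_one, pow_zero, one_mul]
    simp
  | succ b ih =>
    obtain rfl : m = (b + k) + 1 := by lia
    rw [pow_succ', mul_assoc, ← ih _ rfl]
    set T : (b m : ℕ) → Matrix (Fin m) (Fin m) R := fun b m => Matrix.of fun i j =>
      elemTwo e₁ e₂ (((if (i : ℕ) < b then 2 else 1 : ℕ) : ℤ) - (i : ℤ) + (j : ℤ)) with hT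
    change (T (b + 1) (b + k + 1)).det = e₂ * (T b (b + k)).det
    have hsub : (T (b + 1) (b + k + 1)).submatrix Fin.succ Fin.succ = T b (b + k) := by
      ext i j
      simp only [hT, Matrix.submatrix_apply, Matrix.of_apply, Fin.val_succ,
        Nat.add_lt_add_iff_right]
      congr 1
      push_cast
      ring
    rw [Matrix.det_succ_row_zero, Fin.sum_univ_succ, sum_eq_zero, add_zero, Fin.succAbove_zero,
      hsub]
    · simp [hT, elemTwo]
    · intro i _
      have : T (b + 1) (b + k + 1) 0 i.succ = 0 := by
        simp only [hT, Matrix.of_apply]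
        rw [elemTwo_eq_zero]
        simp only [Fin.val_succ, Fin.val_zero, Nat.zero_lt_succ, if_true]
        lia
      rw [this]
      ring

theorem hsym_eq_sum {R : Type*} [CommRing R] (x y : R) (n : ℕ) :
    hsym (x + y) (x * y) n = ∑ p ∈ antidiagonal n, x ^ p.1 * y ^ p.2 := by
  induction n with
  | zero => simp [hsym]
  | succ n ih =>
    rw [hsym_succ_eq, ih, Nat.antidiagonal_succ, sum_cons, sum_map, mul_sum, add_comm]
    congr 1
    · simp
    · refine sum_congr rfl fun p _ => ?_
      simp [pow_succ]
      ring

theorem coeff_mul_hsym (b k : ℕ) (d : Fin 2 →₀ ℕ) :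
    MvPowerSeries.coeff d ((MvPowerSeries.X 0 * MvPowerSeries.X 1) ^ b *
      hsym (MvPowerSeries.X 0 + MvPowerSeries.X 1) (MvPowerSeries.X 0 * MvPowerSeries.X 1) k :
        MvPowerSeries (Fin 2) ℚ) =
      if d 0 + d 1 = 2 * b + k ∧ b ≤ d 0 ∧ b ≤ d 1 then 1 else 0 := by
  classical
  have h : ∀ i j : ℕ, (MvPowerSeries.X 0 * MvPowerSeries.X 1 : MvPowerSeries (Fin 2) ℚ) ^ b *
      (MvPowerSeries.X 0 ^ i * MvPowerSeries.X 1 ^ j) =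
      MvPowerSeries.monomial (Finsupp.single 0 (i + b) + Finsupp.single 1 (j + b)) 1 := by
    intro i j
    have h1 := MvPowerSeries.monomial_mul_monomial (Finsupp.single (0 : Fin 2) (i + b))
      (Finsupp.single 1 (j + b)) (1 : ℚ) 1
    rw [mul_one] at h1
    rw [← h1, ← MvPowerSeries.X_pow_eq, ← MvPowerSeries.X_pow_eq]
    ring
  have h2 : ∀ i j : ℕ, d = Finsupp.single 0 (i + b) + Finsupp.single 1 (j + b) ↔
      d 0 = i + b ∧ d 1 = j + b := by
    intro i j
    rw [Finsupp.ext_iff, Fin.forall_fin_two]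
    simp
  rw [hsym_eq_sum, mul_sum, map_sum]
  simp only [h, MvPowerSeries.coeff_monomial, h2]
  split_ifs with hd
  · rw [sum_eq_single (d 0 - b, d 1 - b), if_pos (by dsimp only; lia)]
    · rintro ⟨i, j⟩ _ hij
      refine if_neg fun h3 => hij ?_
      dsimp only at h3
      rw [Prod.mk.injEq]
      lia
    · intro h3
      rw [HasAntidiagonal.mem_antidiagonal] at h3
      dsimp only at h3
      lia
  · refine sum_eq_zero fun p hp => if_neg ?_
    rw [HasAntidiagonal.mem_antidiagonal] at hp
    lia

theorem killCompl_elemSymm_two (e : Fin 2 ↪ ℕ) (k : ℤ) :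
    MvPowerSeries.killCompl e (elemSymm k : MvPowerSeries ℕ ℚ) =
      elemTwo (MvPowerSeries.X 0 + MvPowerSeries.X 1)
        (MvPowerSeries.X 0 * MvPowerSeries.X 1) k := by
  rcases lt_or_ge k 0 with hk | hk
  · rw [elemSymm_of_neg hk, elemTwo_eq_zero _ _ (Or.inl hk), map_zero]
  · obtain ⟨k, rfl⟩ := Int.eq_ofNat_of_zero_le hk
    rw [killCompl_elemSymm]
    match k with
    | 0 => simp [elemTwo]
    | 1 => simp [elemTwo, Fin.sum_univ_two]
    | 2 =>
      have h : powersetCard 2 (univ : Finset (Fin 2)) = {univ} := powersetCard_self univ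
      simp [elemTwo, MvPolynomial.esymm, h, Fin.prod_univ_two]
    | k + 3 =>
      have h : powersetCard (k + 3) (univ : Finset (Fin 2)) = ∅ :=
        powersetCard_eq_empty.2 (by simp)
      rw [elemTwo_eq_zero _ _ (by lia), MvPolynomial.esymm, h]
      simp

theorem killCompl_schur {n m : ℕ} {L : Fin m → ℕ} {lam : n.Partition} (h : lam.parts.sup = m)
    (hL : ∀ i : Fin m, conjPart lam (i + 1) = L i) (e : Fin 2 ↪ ℕ) :
    MvPowerSeries.killCompl e (schur lam) = (Matrix.of fun i j : Fin m =>
      elemTwo (MvPowerSeries.X 0 + MvPowerSeries.X 1) (MvPowerSeries.X 0 * MvPowerSeries.X 1)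
        ((L i : ℤ) - (i : ℤ) + (j : ℤ))).det := by
  rw [schur_eq_det h hL, AlgHom.map_det]
  congr 1
  ext1 i j
  exact killCompl_elemSymm_two e _

/-- The first row of the determinant has all indices at least 3, so it vanishes in two variables. -/
theorem killCompl_schur_of_two_lt_card {n : ℕ} {lam : n.Partition} (h : 2 < lam.parts.card)
    (e : Fin 2 ↪ ℕ) : MvPowerSeries.killCompl e (schur lam) = 0 := by
  obtain ⟨p, hp⟩ := Multiset.card_pos_iff_exists_mem.1 (by lia : 0 < lam.parts.card)
  have hsup : 0 < lam.parts.sup := (lam.parts_pos hp).trans_le (Multiset.le_sup hp)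
  have h1 : conjPart lam 1 = lam.parts.card := by
    rw [conjPart, Multiset.filter_eq_self.2]
    exact fun _ => lam.parts_pos
  rw [killCompl_schur rfl (fun _ => rfl)]
  refine Matrix.det_eq_zero_of_row_eq_zero ⟨0, hsup⟩ fun j => elemTwo_eq_zero _ _ ?_
  simp only [zero_add, h1]
  lia

theorem exists_parts_eq {n : ℕ} {lam : n.Partition} (h : lam.parts.card ≤ 2) :
    ∃ a b, b ≤ a ∧ a + b = n ∧ lam.parts = Multiset.filter (· ≠ 0) {a, b} := by
  have hsum := lam.parts_sum
  have hpos : ∀ {p}, p ∈ lam.parts → p ≠ 0 := fun hp => (lam.parts_pos hp).ne'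
  interval_cases hc : lam.parts.card
  · rw [Multiset.card_eq_zero] at hc
    rw [hc] at hsum ⊢
    exact ⟨0, 0, le_rfl, by simpa using hsum, rfl⟩
  · obtain ⟨a, ha⟩ := Multiset.card_eq_one.1 hc
    have := hpos (p := a) (by simp [ha])
    rw [ha] at hsum ⊢
    refine ⟨a, 0, Nat.zero_le _, by simpa using hsum, ?_⟩
    simp [Multiset.filter_singleton, this]
  · obtain ⟨a, b, ha⟩ := Multiset.card_eq_two.1 hc
    wlog hab : b ≤ a generalizing a b
    · exact this b a (by rw [ha, Multiset.pair_comm]) (by lia)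
    have h1 := hpos (p := a) (by simp [ha])
    have h2 := hpos (p := b) (by simp [ha])
    rw [ha] at hsum ⊢
    refine ⟨a, b, hab, by simpa using hsum, ?_⟩
    simp [Multiset.filter_singleton, h1, h2]

theorem sup_of_parts_eq {n : ℕ} {lam : n.Partition} {a b : ℕ} (hab : b ≤ a)
    (h : lam.parts = Multiset.filter (· ≠ 0) {a, b}) : lam.parts.sup = a := by
  rw [h]
  by_cases hb : b = 0 <;> by_cases ha : a = 0 <;>
    simp [Multiset.filter_singleton, ha, hb] <;> lia

theorem conjPart_of_parts_eq {n : ℕ} {lam : n.Partition} {a b : ℕ}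
    (h : lam.parts = Multiset.filter (· ≠ 0) {a, b}) {i : ℕ} (hi : i < a) :
    conjPart lam (i + 1) = if i < b then 2 else 1 := by
  rw [conjPart, h, Multiset.filter_filter]
  have : ∀ p, i + 1 ≤ p ∧ p ≠ 0 ↔ i < p := by lia
  simp only [this]
  split_ifs with hb <;> simp [Multiset.filter_singleton, hi, hb]

/-- For parts a ≥ b (zero allowed), `n - lam.parts.sup` is b, and e₂^b h_{a-b} contains exactly the
monomials of degree n with both exponents at least b. -/
theorem coeff_killCompl_schur {n : ℕ} (lam : n.Partition) (e : Fin 2 ↪ ℕ) {d : Fin 2 →₀ ℕ}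
    (hd : d 0 + d 1 = n) :
    MvPowerSeries.coeff d (MvPowerSeries.killCompl e (schur lam)) =
      if lam.parts.card ≤ 2 ∧ n - lam.parts.sup ≤ d 0 ∧ n - lam.parts.sup ≤ d 1 then 1 else 0 := by
  by_cases hc : lam.parts.card ≤ 2
  · obtain ⟨a, b, hab, hn, h⟩ := exists_parts_eq hc
    have hsup := sup_of_parts_eq hab h
    rw [killCompl_schur hsup fun i => conjPart_of_parts_eq h i.2,
      det_elemTwo _ _ b (a - b) a (by lia), coeff_mul_hsym, hsup]
    congr 1
    rw [eq_iff_iff]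
    lia
  · rw [killCompl_schur_of_two_lt_card (by lia), map_zero, if_neg (fun h => hc h.1)]

theorem eq_of_sup_eq {n : ℕ} {lam nu : n.Partition} (h1 : lam.parts.card ≤ 2)
    (h2 : nu.parts.card ≤ 2) (h : lam.parts.sup = nu.parts.sup) : lam = nu := by
  obtain ⟨a, b, hab, hn, ha⟩ := exists_parts_eq h1
  obtain ⟨a', b', hab', hn', ha'⟩ := exists_parts_eq h2
  rw [sup_of_parts_eq hab ha, sup_of_parts_eq hab' ha'] at h
  obtain rfl : b = b' := by lia
  exact Nat.Partition.ext (by rw [ha, ha', h])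

/-- A power series whose coefficients are given by a multiplicative function of the exponents with
log-concave values is 2-Schur-positive. -/
theorem isTwoSchurPositive_of_logConcave {w : ℕ → ℚ} (hw0 : w 0 = 1) (hw : ∀ k, 0 ≤ w k)
    (hlc : ∀ p r, r + 1 ≤ p → w (p + 1) * w r ≤ w p * w (r + 1)) {f : MvPowerSeries ℕ ℚ}
    (hf : ∀ a, MvPowerSeries.coeff a f = a.prod fun _ k => w k) : IsTwoSchurPositive f := by
  obtain ⟨c, hc⟩ := exists_isSchurExpansion w hf
  refine ⟨c, hc, fun n lam hlam => ?_⟩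
  -- Compare coefficients of x^p y^q after restriction to two variables.
  have key : ∀ p q, p + q = n → q ≤ p → w p * w q =
      ∑ nu : n.Partition, if nu.parts.card ≤ 2 ∧ n - nu.parts.sup ≤ q then c n nu else 0 := by
    intro p q hpq hqp
    set d : Fin 2 →₀ ℕ := Finsupp.single 0 p + Finsupp.single 1 q with hd
    have hd0 : d 0 = p := by simp [hd]
    have hd1 : d 1 = q := by simp [hd]
    have := congrArg (fun g => MvPowerSeries.coeff d (MvPowerSeries.killCompl (Fin.valEmbedding) g))
      (hc n)
    have hdeg : d.degree = n := by rw [Finsupp.degree_eq_sum, Fin.sum_univ_two, hd0, hd1, hpq]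
    simp only [map_sum, map_smul, coeff_killCompl_schur _ _ (by lia : d 0 + d 1 = n)] at this
    rw [MvPowerSeries.coeff_killCompl, MvPowerSeries.coeff_homogeneousComponent,
      degree_embDomain, if_pos hdeg, hf, Finsupp.prod_embDomain,
      Finsupp.prod_fintype _ _ (fun _ => hw0), Fin.prod_univ_two, hd0, hd1] at this
    rw [this]
    refine sum_congr rfl fun nu _ => ?_
    rw [smul_eq_mul, mul_ite, mul_one, mul_zero]
    congr 1
    rw [eq_iff_iff]
    lia
  obtain ⟨a, b, hab, hn, h⟩ := exists_parts_eq hlam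
  have hsup := sup_of_parts_eq hab h
  -- Ensures that `n - nu.parts.sup` is not truncated, so that it determines the largest part.
  have hle : ∀ nu : n.Partition, nu.parts.card ≤ 2 → nu.parts.sup ≤ n := by
    intro nu hnu
    obtain ⟨a, b, hab, hn, h⟩ := exists_parts_eq hnu
    rw [sup_of_parts_eq hab h]
    lia
  have hiff : ∀ nu : n.Partition, nu.parts.card ≤ 2 ∧ n - nu.parts.sup = b ↔ nu = lam := by
    intro nu
    constructor
    · rintro ⟨h1, h2⟩
      have := hle nu h1
      exact eq_of_sup_eq h1 hlam (by lia)
    · rintro rfl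
      exact ⟨hlam, by lia⟩
  have hc : c n lam = ∑ nu : n.Partition,
      if nu.parts.card ≤ 2 ∧ n - nu.parts.sup = b then c n nu else 0 := by
    simp only [hiff]
    rw [Finset.sum_ite_eq', if_pos (mem_univ _)]
  have hab' := key a b hn hab
  rcases b with _ | b
  · simp only [Nat.le_zero] at hab'
    rw [hc, ← hab']
    exact mul_nonneg (hw _) (hw _)
  -- Subtracting the sum over second parts at most b from that over second parts at most b + 1
  -- leaves only `lam`.
  · have hab'' := key (a + 1) b (by lia) (by lia)
    have : c n lam = w a * w (b + 1) - w (a + 1) * w b := by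
      rw [hc, hab', hab'', ← sum_sub_distrib]
      refine sum_congr rfl fun nu _ => ?_
      split_ifs <;> first | lia | simp
    rw [this, sub_nonneg]
    exact hlc a b hab

end TwoVariables

end SpiderLC

theorem mainTheorem3 {n : ℕ} (lam : n.Partition) :
    SpiderLC.IsTwoSchurPositive (SpiderLC.Y (SpiderLC.spider lam)) ∧
      SpiderLC.IsStronglyLogConcave (SpiderLC.indepPoly (SpiderLC.spider lam)) := by
  have hpos : ∀ m ∈ SpiderLC.partsList lam, 1 ≤ m := fun m hm =>
    lam.parts_pos ((Multiset.mem_sort _).1 hm)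
  refine ⟨SpiderLC.isTwoSchurPositive_of_logConcave
    (w := fun k => (SpiderLC.indepCount (SpiderLC.spider lam) k : ℚ)) ?_ (fun _ => Nat.cast_nonneg _)
    (fun p r h => ?_) (SpiderLC.coeff_Y _), SpiderLC.stronglyLogConcave_of_le fun p r h =>
      SpiderLC.indepCount_spider_mul_le _ hpos h⟩
  · rw [SpiderLC.indepCount_zero, Nat.cast_one]
  · exact_mod_cast SpiderLC.indepCount_spider_mul_le _ hpos h
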